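/- Logarithms are to base $2$. $\{0,1\}$-strings of length $n$ are written $\{0,1\}^n$, and $y_S$ is the string of the bits of $y$ at the positions in $S$. For a state $\rho_{XE}$ on a finite-dimensional space, $H_{\min}(X|E)_\rho=\max\{\lambda:\ \rho_{XE}\le 2^{-\lambda}\,\mathbb 1_X\otimes\sigma_E \text{ for some normalized state } \sigma_E\}$. **Definitions.** A function $\mathrm{Ext}:\{0,1\}^n\times\{0,1\}^d\to\{0,1\}^m$ is a *$(k,\varepsilon)$-strong extractor* (with uniform seed) if for every distribution $X$ with $-\log\max_x\Pr[X=x]\ge k$ and an independent uniform seed $Y$, the pair $(\mathrm{Ext}(X,Y),Y)$ is within variational distance $\varepsilon$ of uniform. It is a *quantum-proof* $(k,\varepsilon)$-strong extractor if for every normalized state $\rho_{XE}$ classical on $X$ with $H_{\min}(X|E)_\rho\ge k$, and an independent uniform seed $Y$, $\tfrac12\|\rho_{\mathrm{Ext}(X,Y)YE}-\rho_{U_m}\otimes\rho_Y\otimes\rho_E\|_{\mathrm{tr}}\le\varepsilon$. It is *$\ell$-local* if for every fixed seed the output depends on at most $\ell$ input bits. Sets $S_1,\dots,S_m\subseteq[d]$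 form a *weak $(t,r)$-design* if $|S_i|=t$ and $\sum_{j<i}2^{|S_j\cap S_i|}\le rm$ for all $i$. **Theorem.** Let $0<\gamma<\alpha\le1$ and $r>1$ be constants. There are constants $c_0,A_0,B_0>0$ such that for all constants $A\ge A_0$, $B\ge B_0$ there is a constant $K>0$ for which the following holds for all $n,m\in\mathbb N$ and all $0<\varepsilon\le1$ with $m/\varepsilon\ge2$. Put $\delta=\varepsilon^2/(9m^2)$. 1. (Ingredients.) If $\delta>e^{-c_0n}$, then there exist, for some $t$ and $d$, a one-bit $(\gamma n,\delta)$-strong extractor $C:\{0,1\}^n\times\{0,1\}^t\to\{0,1\}$ with $t\le A\log(n/\delta)$ that is $\ell_0$-local for some $\ell_0\le A\log(1/\delta)$, and a weak $(t,r)$-design $S_1,\dots,S_m\subseteq[d]$ with $d\le Bt^2$. 2. (Combination.) For every such $C$ and every such design (with these bounds, for any $t,d$), such as Vadhan's local one-bit extractor and the Hartman–Raz weak design, the function $\mathrm{Ext}(x,y)=C(x,y_{S_1})\cdots C(x,y_{S_m})$ from $\{0,1\}^n\times\{0,1\}^d$ to $\{0,1\}^m$ satisfies: - it is a quantum-proof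 $(\gamma n+rm+2\log m+2\log\frac1\varepsilon+K,\ \varepsilon)$-strong extractor with uniform seed; in particular, if $\gamma n+rm+2\log m+2\log\frac1\varepsilon+K\le\alpha n$, then for every state with $H_{\min}(X|E)=\alpha n$ its output is $\varepsilon$-close (in the above sense) to uniform and independent of $Y$ and $E$; - $d\le K\log^2(n/\varepsilon)$ whenever $m\le n$; - it is $\ell$-local for some $\ell\le K\,m\log(m/\varepsilon)$; - for every fixed seed, each bit of its output depends on at most $K\log(m/\varepsilon)$ bits of the input. -/

import Mathlib

namespace QExt

open scoped Kronecker MatrixOrder ComplexOrder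

/-- Bit strings of length `n`. -/
abbrev BitString (n : ℕ) : Type := Fin n → Bool

/-! ### Finite-dimensional quantum states

A finite-dimensional Hilbert space with a fixed orthonormal basis indexed by a finite type `ι` is
represented by its operators, the complex `ι × ι` matrices. -/

/-- Normalized quantum states: positive semidefinite operators of trace one. -/
def IsState {ι : Type} [Fintype ι] (ρ : Matrix ι ι ℂ) : Prop :=
  ρ.PosSemidef ∧ ρ.trace = 1

/-- The trace norm `tr √(A† A)`. -/
noncomputable def traceNorm {ι : Type} [Fintype ι] [DecidableEq ι] (A : Matrix ι ι ℂ) : ℝ :=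
  (CFC.sqrt (A.conjTranspose * A)).trace.re

/-- The reduced operator on the second system. -/
def reducedSnd {A B : Type} [Fintype A] (ρ : Matrix (A × B) (A × B) ℂ) : Matrix B B ℂ :=
  Matrix.of fun b b' => ∑ a, ρ (a, b) (a, b')

/-- The bipartite operator is classical on the first system, i.e. it has the form
`∑ x, |x⟩⟨x| ⊗ ρ_x` in the given basis of that system. -/
def IsClassicalOnFst {X E : Type} (ρ : Matrix (X × E) (X × E) ℂ) : Prop :=
  ∀ x x' e e', x ≠ x' → ρ (x, e) (x', e') = 0

/-- The conditional min-entropy `H_min(A|B)` of a bipartite operator: the greatest `v` such that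
`ρ ≤ 2^{-v} • 1 ⊗ σ` for some normalized state `σ` of the second system. -/
noncomputable def condMinEntropy {A B : Type} [Fintype A] [DecidableEq A] [Fintype B]
    (ρ : Matrix (A × B) (A × B) ℂ) : ℝ :=
  sSup {v : ℝ | ∃ σ : Matrix B B ℂ, IsState σ ∧
    ρ ≤ (2 : ℝ) ^ (-v) • ((1 : Matrix A A ℂ) ⊗ₖ σ)}

/-- The fully mixed state. -/
noncomputable def mixedState (ι : Type) [Fintype ι] [DecidableEq ι] : Matrix ι ι ℂ :=
  (Fintype.card ι : ℂ)⁻¹ • 1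

/-! ### Extractors -/

section Extractors

variable {n d : ℕ} {Z : Type} [Fintype Z] [DecidableEq Z]

/-- The min-entropy `-log₂ max_x p_x` of a distribution. -/
noncomputable def minEntropy (p : BitString n → ℝ) : ℝ := -Real.logb 2 (⨆ x, p x)

/-- `(k, ε)`-strong extractor with uniform seed (no side information): for every distribution `p`
of `X` with min-entropy at least `k`, the joint distribution of `(Ext(X, Y), Y)` with `Y` uniform
and independent of `X` has variational distance at most `ε` from the uniform distribution. -/
def IsStrongExtractor (Ext : BitString n → BitString d → Z) (k ε : ℝ) : Prop :=
  ∀ p : BitString n → ℝ, (∀ x, 0 ≤ p x) → ∑ x, p x = 1 → k ≤ minEntropy p →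
    1 / 2 * ∑ z : Z, ∑ y : BitString d,
      |(∑ x with Ext x y = z, p x * (2 ^ d : ℝ)⁻¹) - (Fintype.card Z : ℝ)⁻¹ * (2 ^ d : ℝ)⁻¹| ≤ ε

/-- The joint state `∑ x y, 2^{-d} |Ext(x,y), y⟩⟨Ext(x,y), y| ⊗ ρ_x` of the output, the seed and
the side information, for a state `ρ = ∑ x, |x⟩⟨x| ⊗ ρ_x` and an independent uniform seed. -/
noncomputable def outputState {E : Type} (Ext : BitString n → BitString d → Z)
    (ρ : Matrix (BitString n × E) (BitString n × E) ℂ) :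
    Matrix ((Z × BitString d) × E) ((Z × BitString d) × E) ℂ :=
  Matrix.of fun a b =>
    if a.1 = b.1 then (2 ^ d : ℂ)⁻¹ * ∑ x with Ext x a.1.2 = a.1.1, ρ (x, a.2) (x, b.2) else 0

/-- The trace distance `½ ‖ρ_{Ext(X,Y) Y E} - ρ_U ⊗ ρ_Y ⊗ ρ_E‖_tr`. -/
noncomputable def extractionError {E : Type} [Fintype E] [DecidableEq E]
    (Ext : BitString n → BitString d → Z)
    (ρ : Matrix (BitString n × E) (BitString n × E) ℂ) : ℝ :=
  1 / 2 * traceNorm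
    (outputState Ext ρ - (mixedState Z ⊗ₖ mixedState (BitString d)) ⊗ₖ reducedSnd ρ)

/-- Quantum-proof `(k, ε)`-strong extractor with uniform seed. -/
def IsQuantumProof (Ext : BitString n → BitString d → Z) (k ε : ℝ) : Prop :=
  ∀ (E : Type) [Fintype E] [DecidableEq E] (ρ : Matrix (BitString n × E) (BitString n × E) ℂ),
    IsState ρ → IsClassicalOnFst ρ → k ≤ condMinEntropy ρ → extractionError Ext ρ ≤ ε

/-- `ℓ`-local: for every seed, the output depends on at most `ℓ` bits of the input, at positions
determined by the seed. -/
def IsLocal {Z : Type} (ℓ : ℕ) (Ext : BitString n → BitString d → Z) : Prop :=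
  ∀ y, ∃ T : Finset (Fin n), T.card ≤ ℓ ∧
    ∀ x x', (∀ i ∈ T, x i = x' i) → Ext x y = Ext x' y

end Extractors

/-! ### Weak designs and Trevisan's construction -/

/-- `S₁, …, S_m ⊆ [d]` form a weak `(t, r)`-design. -/
structure IsWeakDesign {m d : ℕ} (S : Fin m → Finset (Fin d)) (t : ℕ) (r : ℝ) : Prop where
  card_eq : ∀ i, (S i).card = t
  overlap : ∀ i, ∑ j with j < i, (2 : ℝ) ^ (S j ∩ S i).card ≤ r * m

/-- The string `y_S` of the bits of `y` at the positions in `S`, in increasing order. -/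
def restrictBits {d t : ℕ} (y : BitString d) (S : Finset (Fin d)) (h : S.card = t) :
    BitString t :=
  fun k => y (S.orderEmbOfFin h k)

/-- Trevisan's extractor `Ext_C(x, y) = C(x, y_{S₁}) ⋯ C(x, y_{S_m})`. -/
def trevisan {n m d t : ℕ} (C : BitString n → BitString t → Bool) (S : Fin m → Finset (Fin d))
    (hS : ∀ i, (S i).card = t) (x : BitString n) (y : BitString d) : BitString m :=
  fun i => C x (restrictBits y (S i) (hS i))

/-- `C` is a local one-bit `(γ n, δ)`-strong extractor that has seed length at most
`A log₂ (n/δ)` and that reads at most `A log₂ (1/δ)` bits of its input. -/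
structure IsLocalOneBitExtractor {n t : ℕ} (C : BitString n → BitString t → Bool)
    (A γ δ : ℝ) : Prop where
  seed_le : (t : ℝ) ≤ A * Real.logb 2 (n / δ)
  isLocal : ∃ ℓ : ℕ, (ℓ : ℝ) ≤ A * Real.logb 2 (1 / δ) ∧ IsLocal ℓ C
  strong : IsStrongExtractor C (γ * n) δ

end QExt

namespace QExt

open Finset

/-! Security is reduced bit by bit to the one-bit extractor. The trace distance of the output from
uniform is at most half the sum, over the output bits, of the mean trace norms of the signed
operators `∑ x, ± ρ_x`, where bit `i` is taken given any information that determines the bits before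
it (`sum_traceNorm_sub_uniform_le`). Once the seed outside `S i` is fixed, the truth tables of the
earlier bits on the overlaps `S j ∩ S i` are such information. They depend on the source but not on
the part of the seed read by bit `i`, and the weak design leaves at most `2 ^ (r * m)` of them
(`card_table_le`); this is the entropy cost `r * m`.

What remains is that a classical one-bit extractor withstands quantum side information. By
`traceNorm_le_of_sqrt`, the trace norm of `D = ∑ x, ± ρ_x` is controlled by `tr (D T D T)` with `T`
a regularized inverse square root of `∑ x, ρ_x`. Expanded, this is the signed correlation of the
source with the outcome of the pretty good measurement. For each outcome the source is an ordinary
weighted distribution whose weights are bounded through `ρ_x ≤ p • σ`, so classical extraction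
applies (`IsStrongExtractor.sum_traceNorm_le`). The argument turns error `δ` into order `√δ` per
bit, hence `δ = ε² / (9 m²)`.

The ingredients come from the probabilistic method. The one-bit extractor is a parity of few sampled
positions: it has small bias on strings of large weight, and two samples of the source rarely differ
by a string of small weight. The weak design consists of the graphs of greedily chosen words. -/

/-! ### Bias of a bit and classical min-entropy. -/

/-- The sign `(-1)^b` of a bit. -/
noncomputable def sgn (b : Bool) : ℝ := if b then -1 else 1

@[simp] lemma sgn_true : sgn true = -1 := by simp [sgn]

@[simp] lemma sgn_false : sgn false = 1 := by simp [sgn]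

lemma sgn_xor (a b : Bool) : sgn (a ^^ b) = sgn a * sgn b := by
  cases a <;> cases b <;> simp

lemma abs_sgn (b : Bool) : |sgn b| = 1 := by cases b <;> simp

/-- The error of a one-bit strong extractor is half of the mean absolute bias of its output. -/
lemma sum_abs_bool_eq {n d : ℕ} (C : BitString n → BitString d → Bool) (p : BitString n → ℝ)
    (hp : ∑ x, p x = 1) :
    1 / 2 * ∑ z : Bool, ∑ y : BitString d,
      |(∑ x with C x y = z, p x * (2 ^ d : ℝ)⁻¹) - (Fintype.card Bool : ℝ)⁻¹ * (2 ^ d : ℝ)⁻¹|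
      = 1 / 2 * ((2 ^ d : ℝ)⁻¹ * ∑ y, |∑ x, p x * sgn (C x y)|) := by
  congr 1
  rw [sum_comm, mul_sum]
  refine sum_congr rfl fun y _ => ?_
  have hc : (0 : ℝ) < (2 ^ d : ℝ)⁻¹ := by positivity
  generalize (2 ^ d : ℝ)⁻¹ = c at hc
  have h1 : ∑ x, p x = ∑ x with C x y = true, p x + ∑ x with C x y = false, p x := by
    rw [← sum_filter_add_sum_filter_not univ (fun x => C x y = true)]
    simp
  have h2 : ∑ x, p x * sgn (C x y) =
      -(∑ x with C x y = true, p x) + ∑ x with C x y = false, p x := by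
    rw [← sum_filter_add_sum_filter_not univ (fun x => C x y = true), ← sum_neg_distrib]
    simp only [Bool.not_eq_true]
    congr 1 <;> refine sum_congr rfl fun x hx => ?_ <;> simp [(mem_filter.mp hx).2]
  rw [h2, Fintype.sum_bool, ← sum_mul, ← sum_mul]
  rw [hp] at h1
  generalize ∑ x with C x y = true, p x = a at *
  generalize ∑ x with C x y = false, p x = b at *
  have e1 : a * c - (Fintype.card Bool : ℝ)⁻¹ * c = -(c / 2 * (-a + b)) := by
    simp only [Fintype.card_bool]; push_cast; linear_combination -(c / 2) * h1
  have e2 : b * c - (Fintype.card Bool : ℝ)⁻¹ * c = (c / 2 * (-a + b)) := by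
    simp only [Fintype.card_bool]; push_cast; linear_combination -(c / 2) * h1
  rw [e1, e2, abs_neg, abs_mul, abs_of_pos (half_pos hc)]
  ring

lemma le_of_le_minEntropy {n : ℕ} {p : BitString n → ℝ} (h0 : ∀ x, 0 ≤ p x) (h1 : ∑ x, p x = 1)
    {k : ℝ} (hk : k ≤ minEntropy p) (x : BitString n) : p x ≤ 2 ^ (-k) := by
  have hbdd : BddAbove (Set.range p) := (Set.finite_range p).bddAbove
  have hpos : 0 < ⨆ x, p x := by
    by_contra hcon
    have : ∀ x, p x = 0 := fun x => le_antisymm ((le_ciSup hbdd x).trans (not_lt.mp hcon)) (h0 x)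
    simp [this] at h1
  refine (le_ciSup hbdd x).trans ?_
  rw [← Real.logb_le_iff_le_rpow (by norm_num) hpos]
  unfold minEntropy at hk
  linarith

lemma le_minEntropy {n : ℕ} {p : BitString n → ℝ} (h0 : ∀ x, 0 ≤ p x) (h1 : ∑ x, p x = 1)
    {k : ℝ} (hk : ∀ x, p x ≤ 2 ^ (-k)) : k ≤ minEntropy p := by
  have hbdd : BddAbove (Set.range p) := (Set.finite_range p).bddAbove
  have hpos : 0 < ⨆ x, p x := by
    by_contra hcon
    have : ∀ x, p x = 0 := fun x => le_antisymm ((le_ciSup hbdd x).trans (not_lt.mp hcon)) (h0 x)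
    simp [this] at h1
  have := (Real.logb_le_iff_le_rpow (b := 2) (by norm_num) hpos).mpr (ciSup_le hk)
  unfold minEntropy
  linarith

/-! ### A local one-bit extractor from sampled parities. -/

/-- Chernoff bound and union bound: a random sequence of samples approximates the means of few
bounded functions from above. -/
lemma exists_sample_sum_le {V I Z : Type*} [Fintype V] [Nonempty V] [Fintype I] [DecidableEq I]
    (s : Finset Z) (f : Z → V → ℝ) (hf : ∀ z v, |f z v| ≤ 1) {η : ℝ} (hη0 : 0 < η) (hη1 : η ≤ 1)
    (hmean : ∀ z ∈ s, ∑ v, f z v ≤ η / 2 * Fintype.card V)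
    (hcard : (s.card : ℝ) < Real.exp (Fintype.card I * (η ^ 2 / 16))) :
    ∃ v : I → V, ∀ z ∈ s, ∑ i, f z (v i) ≤ Fintype.card I * η := by
  by_contra! hcon
  set N : ℝ := (Fintype.card I : ℝ) with hN
  have hV : (0 : ℝ) < Fintype.card V := by exact_mod_cast Fintype.card_pos
  -- Exponential moments with parameter `η / 4`. Per sample, the threshold has exponent `η² / 4` and
  -- the moment at most `η² / 8 + η² / 16`; the gap `η² / 16` pays for the union bound.
  have lower : (Fintype.card V : ℝ) ^ Fintype.card I * Real.exp (η / 4 * (N * η)) ≤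
      ∑ v : I → V, ∑ z ∈ s, Real.exp (η / 4 * ∑ i, f z (v i)) := by
    have : ∀ v : I → V, Real.exp (η / 4 * (N * η)) ≤
        ∑ z ∈ s, Real.exp (η / 4 * ∑ i, f z (v i)) := by
      intro v
      obtain ⟨z, hz, hlt⟩ := hcon v
      refine le_trans (Real.exp_le_exp.mpr ?_)
        (single_le_sum (f := fun z => Real.exp (η / 4 * ∑ i, f z (v i)))
          (fun _ _ => (Real.exp_pos _).le) hz)
      gcongr
    refine le_trans (le_of_eq ?_) (sum_le_sum fun v _ => this v)
    simp [Fintype.card_pi]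
  have mgf : ∀ z ∈ s, ∑ v, Real.exp (η / 4 * f z v) ≤
      Fintype.card V * Real.exp (η / 4 * (η / 2) + (η / 4) ^ 2) := by
    intro z hz
    have h1 : ∀ v, Real.exp (η / 4 * f z v) ≤ 1 + η / 4 * f z v + (η / 4) ^ 2 := by
      intro v
      have habs : |η / 4 * f z v| ≤ η / 4 := by
        rw [abs_mul, abs_of_pos (by positivity)]
        exact mul_le_of_le_one_right (by positivity) (hf z v)
      have h2 := Real.abs_exp_sub_one_sub_id_le (x := η / 4 * f z v) (by linarith)
      have h3 : (η / 4 * f z v) ^ 2 ≤ (η / 4) ^ 2 := sq_le_sq' (abs_le.mp habs).1 (abs_le.mp habs).2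
      linarith [(abs_le.mp h2).2]
    calc ∑ v, Real.exp (η / 4 * f z v) ≤ ∑ v, (1 + η / 4 * f z v + (η / 4) ^ 2) :=
          sum_le_sum fun v _ => h1 v
      _ = Fintype.card V * (1 + (η / 4) ^ 2) + η / 4 * ∑ v, f z v := by
          simp only [sum_add_distrib, ← mul_sum, sum_const, card_univ, nsmul_eq_mul]; ring
      _ ≤ Fintype.card V * (1 + (η / 4) ^ 2) + η / 4 * (η / 2 * Fintype.card V) := by
          gcongr; exact hmean z hz
      _ = Fintype.card V * ((η / 4 * (η / 2) + (η / 4) ^ 2) + 1) := by ring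
      _ ≤ _ := by gcongr; exact Real.add_one_le_exp _
  have upper : ∑ v : I → V, ∑ z ∈ s, Real.exp (η / 4 * ∑ i, f z (v i)) ≤
      s.card * ((Fintype.card V : ℝ) ^ Fintype.card I *
        Real.exp (N * (η / 4 * (η / 2) + (η / 4) ^ 2))) := by
    rw [sum_comm, ← nsmul_eq_mul]
    refine sum_le_card_nsmul _ _ _ fun z hz => ?_
    have : ∑ v : I → V, Real.exp (η / 4 * ∑ i, f z (v i)) =
        ∏ _i : I, ∑ v, Real.exp (η / 4 * f z v) := by
      rw [prod_univ_sum, Fintype.piFinset_univ]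
      simp [mul_sum, Real.exp_sum]
    rw [this, prod_const, card_univ, hN, Real.exp_nat_mul, ← mul_pow]
    exact pow_le_pow_left₀ (sum_nonneg fun _ _ => (Real.exp_pos _).le) (mgf z hz) _
  have hVN : (0 : ℝ) < (Fintype.card V : ℝ) ^ Fintype.card I := by positivity
  have key := lower.trans upper
  rw [mul_left_comm (s.card : ℝ), mul_le_mul_iff_right₀ hVN] at key
  have : Real.exp (N * (η ^ 2 / 16)) * Real.exp (N * (η / 4 * (η / 2) + (η / 4) ^ 2)) =
      Real.exp (η / 4 * (N * η)) := by
    rw [← Real.exp_add]; congr 1; ring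
  rw [← this, mul_le_mul_iff_left₀ (Real.exp_pos _)] at key
  exact absurd hcard (not_lt.mpr key)

/-- The number of ones of a bit string. -/
def weight {n : ℕ} (z : BitString n) : ℕ := (univ.filter fun i => z i = true).card

/-- Volume of a Hamming ball. -/
lemma card_weight_lt_le {n : ℕ} {q τ : ℝ} (hq0 : 0 < q) (hq1 : q ≤ 1) :
    (((univ : Finset (BitString n)).filter fun z => (weight z : ℝ) < τ * n).card : ℝ) *
      q ^ (τ * n) ≤ (1 + q) ^ n := by
  have h1 : (1 + q) ^ n = ∑ z : BitString n, q ^ weight z := by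
    have h2 : (1 + q) = ∑ b : Bool, if b then q else 1 := by simp [add_comm]
    rw [h2, Fintype.sum_pow]
    refine sum_congr rfl fun z _ => ?_
    simp [prod_ite, weight]
  rw [h1, ← nsmul_eq_mul]
  refine (card_nsmul_le_sum _ _ _ fun z hz => ?_).trans
    (sum_le_sum_of_subset_of_nonneg (filter_subset _ univ) fun _ _ _ => by positivity)
  rw [← Real.rpow_natCast]
  exact Real.rpow_le_rpow_of_exponent_ge hq0 hq1 (mem_filter.mp hz).2.le

/-- Parity of the bits of `x` selected by a list of positions and enabling bits. -/
noncomputable def parity {n l : ℕ} (x : BitString n) (v : Fin l → Fin n × Bool) : Bool :=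
  decide (∏ k, sgn ((v k).2 && x (v k).1) = -1)

lemma sgn_parity {n l : ℕ} (x : BitString n) (v : Fin l → Fin n × Bool) :
    sgn (parity x v) = ∏ k, sgn ((v k).2 && x (v k).1) := by
  have : ∀ s : Finset (Fin l), ∏ k ∈ s, sgn ((v k).2 && x (v k).1) = 1 ∨
      ∏ k ∈ s, sgn ((v k).2 && x (v k).1) = -1 := by
    intro s
    induction s using Finset.induction_on with
    | empty => simp
    | insert a s ha ih =>
      rw [prod_insert ha]
      rcases ih with h | h <;> rw [h] <;> cases ((v a).2 && x (v a).1) <;> simp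
  rcases this univ with h | h <;> simp [parity, h]
  norm_num [sgn]

/-- Parity is linear in the input. This reduces second moments over pairs of inputs to the bias at
single strings. -/
lemma sgn_parity_mul {n l : ℕ} (x x' : BitString n) (v : Fin l → Fin n × Bool) :
    sgn (parity x v) * sgn (parity x' v) = sgn (parity (fun i => x i ^^ x' i) v) := by
  rw [sgn_parity, sgn_parity, sgn_parity, ← prod_mul_distrib]
  refine prod_congr rfl fun k _ => ?_
  rw [← sgn_xor]
  cases (v k).2 <;> simp

/-- The `l` choices are independent. The random enabling bit makes the mean sign of one choice `1 -
w / n` instead of `1 - 2 w / n`, so that it is nonnegative and strings of weight near `n` have small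
bias too. -/
lemma sum_sgn_parity {n l : ℕ} (hn : 0 < n) (z : BitString n) :
    ∑ v : Fin l → Fin n × Bool, sgn (parity z v) =
      (1 - weight z / n) ^ l * Fintype.card (Fin l → Fin n × Bool) := by
  have h1 : ∑ a : Fin n × Bool, sgn (a.2 && z a.1) = (1 - weight z / n) * (2 * n) := by
    rw [Fintype.sum_prod_type]
    have h2 : ∀ i, ∑ b : Bool, sgn (b && z i) = 2 - 2 * (if z i = true then 1 else 0) := by
      intro i; cases z i <;> norm_num
    rw [sum_congr rfl fun i _ => h2 i, sum_sub_distrib, ← mul_sum, sum_boole]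
    have : (n : ℝ) ≠ 0 := by positivity
    simp only [weight, sum_const, card_univ, Fintype.card_fin, nsmul_eq_mul]
    field_simp
  simp only [sgn_parity]
  rw [← Fintype.sum_pow (fun a : Fin n × Bool => sgn (a.2 && z a.1)), h1, mul_pow]
  simp [Fintype.card_pi, mul_comm]

/-- Parities of few bits with small bias on all heavy strings. -/
lemma exists_parity_sample {n l t : ℕ} (hn : 0 < n) {τ η : ℝ} (hη0 : 0 < η) (hη1 : η ≤ 1)
    (hl : Real.exp (-(τ * l)) ≤ η / 2) (ht : 16 * n ≤ (2 : ℝ) ^ t * η ^ 2) :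
    ∃ v : BitString t → Fin l → Fin n × Bool, ∀ z : BitString n, τ * n ≤ weight z →
      ∑ y, sgn (parity z (v y)) ≤ 2 ^ t * η := by
  have : Nonempty (Fin n) := ⟨⟨0, hn⟩⟩
  have hn' : (0 : ℝ) < n := by exact_mod_cast hn
  obtain ⟨v, hv⟩ := exists_sample_sum_le (I := BitString t)
    ((univ : Finset (BitString n)).filter fun z => τ * n ≤ weight z)
    (fun z (v : Fin l → Fin n × Bool) => sgn (parity z v)) (fun z v => (abs_sgn _).le) hη0 hη1
    (fun z hz => by
      rw [sum_sgn_parity hn]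
      gcongr
      refine le_trans ?_ hl
      have hw : (weight z : ℝ) ≤ n := by
        exact_mod_cast (card_filter_le _ _).trans (by simp)
      have h0 : 0 ≤ 1 - (weight z : ℝ) / n := by
        rw [sub_nonneg, div_le_one hn']; exact hw
      have h1 : 1 - (weight z : ℝ) / n ≤ Real.exp (-τ) := by
        have h2 : τ ≤ weight z / n := by
          rw [le_div_iff₀ hn']; exact (mem_filter.mp hz).2
        linarith [Real.add_one_le_exp (-τ)]
      calc (1 - (weight z : ℝ) / n) ^ l ≤ Real.exp (-τ) ^ l := pow_le_pow_left₀ h0 h1 _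
        _ = _ := by rw [← Real.exp_nat_mul]; congr 1; ring)
    (by
      have h1 : ((((univ : Finset (BitString n)).filter fun z => τ * n ≤ weight z).card : ℕ) : ℝ)
          ≤ 2 ^ n := by
        have := card_filter_le (univ : Finset (BitString n)) (fun z => τ * n ≤ weight z)
        simp only [card_univ, Fintype.card_pi, Fintype.card_bool, prod_const, Fintype.card_fin]
          at this
        exact_mod_cast this
      -- The union bound runs over at most `2 ^ n < e ^ n` strings, and `ht` makes the Chernoff
      -- exponent at least `n`.
      refine h1.trans_lt ?_
      have h2 : (2 : ℝ) ^ n < Real.exp 1 ^ n :=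
        pow_lt_pow_left₀ (by linarith [Real.exp_one_gt_d9]) (by norm_num) hn.ne'
      refine h2.trans_le ?_
      rw [← Real.exp_nat_mul, mul_one, Real.exp_le_exp]
      simp only [Fintype.card_pi, Fintype.card_bool, prod_const, card_univ, Fintype.card_fin]
      push_cast
      linarith)
  refine ⟨v, fun z hz => ?_⟩
  have := hv z (by simpa using hz)
  simpa using this

/-- Parities with small bias on all heavy strings form a strong extractor. -/
lemma isStrongExtractor_parity {n l t : ℕ} {τ k δ : ℝ} (hδ : 0 < δ)
    (v : BitString t → Fin l → Fin n × Bool)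
    (hv : ∀ z : BitString n, τ * n ≤ weight z → ∑ y, sgn (parity z (v y)) ≤ 2 ^ t * δ ^ 2)
    (hvol : (((univ : Finset (BitString n)).filter fun z => (weight z : ℝ) < τ * n).card : ℝ) *
      2 ^ (-k) ≤ δ ^ 2) :
    IsStrongExtractor (fun x y => parity x (v y)) k δ := by
  intro p hp0 hp1 hk
  have hpk := le_of_le_minEntropy hp0 hp1 hk
  rw [sum_abs_bool_eq _ _ hp1]
  set c : ℝ := (2 ^ t : ℝ)⁻¹ with hc
  have hc0 : 0 < c := by positivity
  have hct : c * 2 ^ t = 1 := by rw [hc]; field_simp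
  set xr : BitString n → BitString n → BitString n := fun x x' i => x i ^^ x' i with hxr
  -- Pairs with heavy difference contribute at most `δ ^ 2` by `hv`. The light differences have
  -- total mass at most `δ ^ 2`, being few (`hvol`) while each `p x'` is at most `2 ^ (-k)`. Upper
  -- bounds on the signed sums suffice because the weights `p x * p x'` are nonnegative.
  have second : c * ∑ y, (∑ x, p x * sgn (parity x (v y))) ^ 2 ≤ 2 * δ ^ 2 := by
    have e1 : ∀ x x', c * ∑ y, sgn (parity (xr x x') (v y)) ≤
        δ ^ 2 + if (weight (xr x x') : ℝ) < τ * n then 1 else 0 := by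
      intro x x'
      split_ifs with h
      · have : ∑ y, sgn (parity (xr x x') (v y)) ≤ 2 ^ t := by
          refine (sum_le_sum fun y _ => (le_abs_self _).trans (abs_sgn _).le).trans ?_
          simp
        have := mul_le_mul_of_nonneg_left this hc0.le
        nlinarith [sq_nonneg δ]
      · have := mul_le_mul_of_nonneg_left (hv _ (not_lt.mp h)) hc0.le
        rw [← mul_assoc, hct] at this
        linarith
    have e2 : ∀ x, ∑ x', p x' * (if (weight (xr x x') : ℝ) < τ * n then (1 : ℝ) else 0) ≤
        δ ^ 2 := by
      intro x
      refine le_trans ?_ hvol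
      have hinv : Function.Involutive (xr x) := by
        intro z; funext i; simp [hxr]
      rw [← Equiv.sum_comp hinv.toPerm]
      simp only [Function.Involutive.coe_toPerm, hinv _]
      calc ∑ z, p (xr x z) * (if (weight z : ℝ) < τ * n then (1 : ℝ) else 0)
          ≤ ∑ z, 2 ^ (-k) * (if (weight z : ℝ) < τ * n then (1 : ℝ) else 0) := by
            gcongr with z
            exact hpk _
        _ = _ := by rw [← mul_sum, sum_boole, mul_comm]
    calc c * ∑ y, (∑ x, p x * sgn (parity x (v y))) ^ 2
        = ∑ x, ∑ x', p x * p x' * (c * ∑ y, sgn (parity (xr x x') (v y))) := by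
          have h1 : ∀ y, (∑ x, p x * sgn (parity x (v y))) ^ 2 =
              ∑ x, ∑ x', p x * p x' * sgn (parity (xr x x') (v y)) := by
            intro y
            rw [sq, sum_mul_sum]
            refine sum_congr rfl fun x _ => sum_congr rfl fun x' _ => ?_
            rw [hxr, ← sgn_parity_mul]; ring
          rw [sum_congr rfl fun y _ => h1 y, sum_comm, mul_sum]
          refine sum_congr rfl fun x _ => ?_
          rw [sum_comm, mul_sum]
          refine sum_congr rfl fun x' _ => ?_
          rw [← mul_sum]; ring
      _ ≤ ∑ x, ∑ x', p x * p x' * (δ ^ 2 + if (weight (xr x x') : ℝ) < τ * n then 1 else 0) := by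
          gcongr with x _ x' _
          · exact mul_nonneg (hp0 _) (hp0 _)
          · exact e1 x x'
      _ = ∑ x, p x * (δ ^ 2 * (∑ x', p x') +
            ∑ x', p x' * (if (weight (xr x x') : ℝ) < τ * n then (1 : ℝ) else 0)) := by
          refine sum_congr rfl fun x _ => ?_
          rw [mul_sum, ← sum_add_distrib, mul_sum]
          refine sum_congr rfl fun x' _ => ?_
          ring
      _ ≤ ∑ x, p x * (δ ^ 2 * 1 + δ ^ 2) := by
          gcongr with x _
          · exact hp0 x
          · exact hp1.le
          · exact e2 x
      _ = 2 * δ ^ 2 := by rw [← sum_mul, hp1]; ring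
  have first : c * ∑ y, |∑ x, p x * sgn (parity x (v y))| ≤
      δ + c * (∑ y, (∑ x, p x * sgn (parity x (v y))) ^ 2) / (4 * δ) := by
    have amgm : ∀ a : ℝ, |a| ≤ δ + a ^ 2 / (4 * δ) := by
      intro a
      rw [← sub_nonneg]
      have : δ + a ^ 2 / (4 * δ) - |a| = (2 * δ - |a|) ^ 2 / (4 * δ) := by
        rw [← sq_abs a]; field_simp; ring
      rw [this]; positivity
    refine (mul_le_mul_of_nonneg_left (sum_le_sum fun y _ => amgm _) hc0.le).trans (le_of_eq ?_)
    rw [sum_add_distrib, ← sum_div, sum_const, card_univ, nsmul_eq_mul, mul_add, ← mul_assoc,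
      mul_div_assoc]
    simp only [Fintype.card_pi, Fintype.card_bool, prod_const, card_univ, Fintype.card_fin]
    push_cast
    rw [hct, one_mul]
  have third : c * (∑ y, (∑ x, p x * sgn (parity x (v y))) ^ 2) / (4 * δ) ≤ δ := by
    rw [div_le_iff₀ (by positivity)]
    nlinarith
  linarith

lemma isLocal_parity {n l t : ℕ} (v : BitString t → Fin l → Fin n × Bool) :
    IsLocal l (fun x y => parity x (v y) : BitString n → BitString t → Bool) := by
  intro y
  refine ⟨univ.image fun k => (v y k).1, card_image_le.trans (by simp), fun x x' h => ?_⟩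
  have : ∀ k, x (v y k).1 = x' (v y k).1 := fun k => h _ (mem_image_of_mem _ (mem_univ k))
  simp [parity, this]

/-! ### Weak designs. -/

/-- The summand factors over the positions, and each position contributes `2 + (b - 1)`. On average
over `w` this gives `(1 + 1 / b) ^ t`. -/
lemma sum_two_pow_agree {t b : ℕ} (u : Fin t → Fin b) :
    ∑ w : Fin t → Fin b, (2 : ℝ) ^ (univ.filter fun k => u k = w k).card = (b + 1) ^ t := by
  have h1 : ∀ w : Fin t → Fin b, (2 : ℝ) ^ (univ.filter fun k => u k = w k).card =
      ∏ k, if u k = w k then 2 else 1 := by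
    intro w; simp [prod_ite]
  simp only [h1]
  rw [← Fintype.piFinset_univ, ← prod_univ_sum (fun _ => univ) fun k a =>
    (if u k = a then (2 : ℝ) else 1)]
  have h2 : ∀ k : Fin t, ∑ a : Fin b, (if u k = a then (2 : ℝ) else 1) = b + 1 := by
    intro k
    have : ∀ a : Fin b, (if u k = a then (2 : ℝ) else 1) = 1 + if u k = a then 1 else 0 := by
      intro a; split_ifs <;> norm_num
    simp [this, sum_add_distrib]
  simp [h2]

/-- Greedy choice of words with few pairwise agreements. -/
lemma exists_words {t b : ℕ} {r : ℝ} (h : ((b : ℝ) + 1) ^ t ≤ r * (b : ℝ) ^ t) (m : ℕ) :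
    ∃ u : ℕ → Fin t → Fin b, ∀ i < m,
      ∑ j ∈ range i, (2 : ℝ) ^ (univ.filter fun k => u j k = u i k).card ≤ r * i := by
  have hne : Nonempty (Fin t → Fin b) := by
    rw [← Fintype.card_pos_iff, Fintype.card_pi]
    simp only [Fintype.card_fin, prod_const, card_univ]
    refine Nat.pos_of_ne_zero fun h0 => ?_
    have h0' : (b : ℝ) ^ t = 0 := by exact_mod_cast h0
    have : (0 : ℝ) < (b + 1) ^ t := by positivity
    rw [h0', mul_zero] at h
    linarith
  induction m with
  | zero => exact ⟨fun _ => Classical.arbitrary _, fun i hi => absurd hi (Nat.not_lt_zero i)⟩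
  | succ m ih =>
    obtain ⟨u, hu⟩ := ih
    -- Averaged over all words, the overlap sum with the `m` words already chosen is at most `r *
    -- m`, so some word attains this.
    obtain ⟨w, -, hw⟩ := exists_le_of_sum_le (s := (univ : Finset (Fin t → Fin b)))
      (f := fun w => ∑ j ∈ range m, (2 : ℝ) ^ (univ.filter fun k => u j k = w k).card)
      (g := fun _ => r * m) univ_nonempty (by
        rw [sum_comm, sum_congr rfl fun j _ => sum_two_pow_agree (u j)]
        simp only [sum_const, card_range, card_univ, Fintype.card_pi, Fintype.card_fin,
          prod_const, nsmul_eq_mul]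
        push_cast
        have := mul_le_mul_of_nonneg_left h (Nat.cast_nonneg (α := ℝ) m)
        linarith)
    refine ⟨Function.update u m w, fun i hi => ?_⟩
    have hlt : ∀ j ∈ range i, Function.update u m w j = u j := fun j hj =>
      Function.update_of_ne (by have := mem_range.mp hj; omega) _ _
    rw [sum_congr rfl fun j hj => by rw [hlt j hj]]
    rcases Nat.lt_succ_iff_lt_or_eq.mp hi with hi' | rfl
    · rw [Function.update_of_ne hi'.ne]; exact hu i hi'
    · rw [Function.update_self]; exact hw

/-- Weak designs of any number of sets from a partition of the universe into blocks. -/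
lemma exists_isWeakDesign_of_pow_le {t b : ℕ} {r : ℝ} (hr : 0 ≤ r)
    (h : ((b : ℝ) + 1) ^ t ≤ r * (b : ℝ) ^ t) (m : ℕ) :
    ∃ S : Fin m → Finset (Fin (t * b)), IsWeakDesign S t r := by
  obtain ⟨u, hu⟩ := exists_words h m
  have hinj : ∀ i, Function.Injective fun k => finProdFinEquiv (k, u i k) := fun i k k' hk => by
    simpa using congrArg Prod.fst (finProdFinEquiv.injective hk)
  -- The sets are the graphs of the words in `[t] × [b]`; two graphs meet exactly where the words
  -- agree.
  refine ⟨fun i => univ.image fun k => finProdFinEquiv (k, u i k), fun i => ?_, fun i => ?_⟩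
  · rw [card_image_of_injective _ (hinj i)]; simp
  · have hcard : ∀ j : Fin m, ((univ.image fun k => finProdFinEquiv (k, u j k)) ∩
        univ.image fun k => finProdFinEquiv (k, u i k)).card =
        (univ.filter fun k => u j k = u i k).card := by
      intro j
      rw [← card_image_of_injective _ (hinj i)]
      congr 1
      ext a
      simp only [mem_inter, mem_image, mem_univ, true_and, mem_filter]
      constructor
      · rintro ⟨⟨k, rfl⟩, k', hk'⟩
        have := finProdFinEquiv.injective hk'
        simp only [Prod.mk.injEq] at this
        obtain ⟨rfl, h2⟩ := this
        exact ⟨k', h2.symm, hk'⟩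
      · rintro ⟨k, hk, rfl⟩
        exact ⟨⟨k, by rw [hk]⟩, k, rfl⟩
    simp only [hcard]
    have hsum : ∑ j : Fin m with j < i, (2 : ℝ) ^ (univ.filter fun k => u j k = u i k).card =
        ∑ j ∈ range i, (2 : ℝ) ^ (univ.filter fun k => u j k = u i k).card := by
      refine sum_bij (fun j _ => (j : ℕ)) (fun j hj => ?_) (fun _ _ _ _ h => Fin.ext h)
        (fun j hj => ?_) (fun _ _ => rfl)
      · simpa using hj
      · have hj' := mem_range.mp hj
        exact ⟨⟨j, hj'.trans i.2⟩, mem_filter.mpr ⟨mem_univ _, hj'⟩, rfl⟩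
    rw [hsum]
    refine (hu i i.2).trans ?_
    gcongr
    exact i.2.le

/-- Weak designs with universe of quadratic size. -/
lemma exists_isWeakDesign {r : ℝ} (hr : 1 < r) (t m : ℕ) :
    ∃ (d : ℕ) (S : Fin m → Finset (Fin d)), IsWeakDesign S t r ∧
      (d : ℝ) ≤ (1 / Real.log r + 1) * (t : ℝ) ^ 2 := by
  have hlog : 0 < Real.log r := Real.log_pos hr
  -- For `t = 0` the block size `⌈t / log r⌉` chosen below would vanish. For `t > 0` it yields `(1 +
  -- 1 / b) ^ t ≤ exp (t / b) ≤ r`.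
  rcases Nat.eq_zero_or_pos t with rfl | ht
  · obtain ⟨S, hS⟩ := exists_isWeakDesign_of_pow_le (t := 0) (b := 1) (r := r) (by linarith)
      (by simpa using hr.le) m
    exact ⟨_, S, hS, by simp⟩
  have ht' : (1 : ℝ) ≤ t := by exact_mod_cast ht
  set b := ⌈t / Real.log r⌉₊ with hb
  have hb1 : (t : ℝ) / Real.log r ≤ b := Nat.le_ceil _
  have hb2 : (b : ℝ) ≤ t / Real.log r + 1 := (Nat.ceil_lt_add_one (by positivity)).le
  have hb0 : (0 : ℝ) < b := lt_of_lt_of_le (by positivity) hb1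
  obtain ⟨S, hS⟩ := exists_isWeakDesign_of_pow_le (t := t) (b := b) (r := r) (by linarith) (by
    have h1 : ((b : ℝ) + 1) = b * (1 / b + 1) := by field_simp; ring
    rw [h1, mul_pow, mul_comm]
    gcongr
    calc (1 / (b : ℝ) + 1) ^ t ≤ Real.exp (1 / b) ^ t := by gcongr; exact Real.add_one_le_exp _
      _ = Real.exp (t / b) := by rw [← Real.exp_nat_mul]; congr 1; ring
      _ ≤ Real.exp (Real.log r) := by
        rw [Real.exp_le_exp, div_le_iff₀ hb0]; rwa [div_le_iff₀ hlog, mul_comm] at hb1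
      _ = r := Real.exp_log (by linarith)) m
  refine ⟨_, S, hS, ?_⟩
  push_cast
  calc (t : ℝ) * b ≤ t * (t / Real.log r + t) := by gcongr; linarith
    _ = _ := by ring

open Matrix
open scoped Kronecker MatrixOrder ComplexOrder

/-! ### Trace norm: duality and a weighted Hilbert-Schmidt bound. -/

section Trace

variable {ι : Type} [Fintype ι] [DecidableEq ι]

lemma trace_mul_re_nonneg {A B : Matrix ι ι ℂ} (hA : A.PosSemidef) (hB : B.PosSemidef) :
    0 ≤ (A * B).trace.re := by
  have h1 : CFC.sqrt A * CFC.sqrt A = A := CFC.sqrt_mul_sqrt_self A hA.nonneg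
  have h2 : (CFC.sqrt A).PosSemidef := (CFC.sqrt_nonneg A).posSemidef
  rw [← h1, mul_assoc, trace_mul_comm]
  have := (hB.mul_mul_conjTranspose_same (CFC.sqrt A)).trace_nonneg
  rw [h2.1.eq] at this
  exact (Complex.le_def.mp this).1

lemma trace_mul_re_le {A B C : Matrix ι ι ℂ} (hA : A.PosSemidef) (h : B ≤ C) :
    (A * B).trace.re ≤ (A * C).trace.re := by
  have := trace_mul_re_nonneg hA (Matrix.le_iff.mp h)
  rw [mul_sub, trace_sub, Complex.sub_re] at this
  linarith

omit [DecidableEq ι] in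
lemma trace_mul_self_re_nonneg {A : Matrix ι ι ℂ} (hA : A.IsHermitian) :
    0 ≤ (A * A).trace.re := by
  have := (posSemidef_conjTranspose_mul_self A).trace_nonneg
  rw [hA.eq] at this
  exact (Complex.le_def.mp this).1

lemma trace_mul_le_traceNorm {A S : Matrix ι ι ℂ} (hA : A.IsHermitian) (hS1 : -1 ≤ S)
    (hS2 : S ≤ 1) : (A * S).trace.re ≤ traceNorm A := by
  have hsa : IsSelfAdjoint A := hA
  have e1 : A⁺ - A⁻ = A := CFC.posPart_sub_negPart A hsa
  have e2 : A⁺ + A⁻ = CFC.sqrt (A.conjTranspose * A) := CFC.posPart_add_negPart A hsa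
  have p1 : (A⁺).PosSemidef := (CFC.posPart_nonneg A).posSemidef
  have p2 : (A⁻).PosSemidef := (CFC.negPart_nonneg A).posSemidef
  unfold traceNorm
  rw [← e2]
  nth_rewrite 1 [← e1]
  have h1 := trace_mul_re_le p1 hS2
  have h2 := trace_mul_re_le p2 hS1
  simp only [mul_neg, mul_one, trace_neg, Complex.neg_re] at h1 h2
  simp only [sub_mul, trace_sub, trace_add, Complex.sub_re, Complex.add_re]
  linarith

/-- The witness is the sign of `A`, with value `1` at zero. With `trace_mul_le_traceNorm` it makes
the trace norm a maximum of linear functionals, from which the triangle inequality and the bound on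
block-diagonal operators follow. -/
lemma exists_trace_mul_eq_traceNorm {A : Matrix ι ι ℂ} (hA : A.IsHermitian) :
    ∃ S : Matrix ι ι ℂ, -1 ≤ S ∧ S ≤ 1 ∧ (A * S).trace.re = traceNorm A := by
  have hsa : IsSelfAdjoint A := hA
  have hc : ∀ f : ℝ → ℝ, ContinuousOn f (spectrum ℝ A) := fun f =>
    (finite_real_spectrum (A := A)).continuousOn f
  refine ⟨cfc (fun x : ℝ => if 0 ≤ x then 1 else -1) A, ?_, ?_, ?_⟩
  · rw [neg_le_iff_add_nonneg, ← cfc_one ℝ A, ← cfc_add A _ _ (hc _) (hc _)]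
    refine cfc_nonneg fun x _ => ?_
    simp only [Pi.one_apply]
    split_ifs <;> norm_num
  · exact cfc_le_one _ _ fun x _ => by split_ifs <;> norm_num
  · unfold traceNorm
    have h1 : CFC.sqrt (A.conjTranspose * A) = CFC.abs A := rfl
    rw [h1, CFC.abs_eq_cfc_norm A hsa]
    congr 2
    conv_lhs => rw [← cfc_id ℝ A hsa]
    nth_rewrite 2 [cfc_id ℝ A hsa]
    rw [← cfc_mul _ _ _ (hc _) (hc _)]
    refine cfc_congr fun x _ => ?_
    simp only [id, Real.norm_eq_abs]
    split_ifs with h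
    · rw [abs_of_nonneg h, mul_one]
    · rw [abs_of_neg (not_le.mp h)]; ring

lemma traceNorm_add_le {A B : Matrix ι ι ℂ} (hA : A.IsHermitian) (hB : B.IsHermitian) :
    traceNorm (A + B) ≤ traceNorm A + traceNorm B := by
  obtain ⟨S, h1, h2, h3⟩ := exists_trace_mul_eq_traceNorm (hA.add hB)
  rw [← h3, add_mul, trace_add, Complex.add_re]
  exact add_le_add (trace_mul_le_traceNorm hA h1 h2) (trace_mul_le_traceNorm hB h1 h2)

lemma traceNorm_sum_le {κ : Type*} (s : Finset κ) (A : κ → Matrix ι ι ℂ)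
    (hA : ∀ k ∈ s, (A k).IsHermitian) : traceNorm (∑ k ∈ s, A k) ≤ ∑ k ∈ s, traceNorm (A k) := by
  obtain ⟨S, h1, h2, h3⟩ := exists_trace_mul_eq_traceNorm (isSelfAdjoint_sum s hA)
  rw [← h3, sum_mul, trace_sum, Complex.re_sum]
  exact sum_le_sum fun k hk => trace_mul_le_traceNorm (hA k hk) h1 h2

/-- The trace norm of a Hermitian matrix is bounded by its weighted Hilbert-Schmidt norm. -/
lemma traceNorm_le_of_sqrt {D R : Matrix ι ι ℂ} (hD : D.IsHermitian) (hR : R.PosDef) {c : ℝ}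
    (hc : 0 < c) :
    traceNorm D ≤ c / 2 * (R * R).trace.re + 1 / (2 * c) * (D * R⁻¹ * D * R⁻¹).trace.re := by
  obtain ⟨S, h1, h2, h3⟩ := exists_trace_mul_eq_traceNorm hD
  rw [← h3]
  have hS : S.IsHermitian := by
    have := (Matrix.le_iff.mp h2).1
    have h4 : S = 1 - (1 - S) := by abel
    rw [h4]; exact isHermitian_one.sub this
  set Q := CFC.sqrt R with hQ
  have hQQ : Q * Q = R := CFC.sqrt_mul_sqrt_self R hR.posSemidef.nonneg
  have hQh : Q.IsHermitian := (CFC.sqrt_nonneg R).posSemidef.1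
  have hRdet : IsUnit R.det := hR.det_pos.ne'.isUnit
  have hQdet : IsUnit Q.det := by
    rw [← hQQ, det_mul] at hRdet; exact isUnit_of_mul_isUnit_left hRdet
  have hQi : Q⁻¹.IsHermitian := hQh.inv
  have hRi : R⁻¹ = Q⁻¹ * Q⁻¹ := by rw [← hQQ, Matrix.mul_inv_rev]
  have c1 : Q * Q⁻¹ = 1 := mul_nonsing_inv _ hQdet
  have c2 : Q⁻¹ * Q = 1 := nonsing_inv_mul _ hQdet
  have herm : ∀ {X Y : Matrix ι ι ℂ}, X.IsHermitian → Y.IsHermitian → (X * Y * X).IsHermitian := by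
    intro X Y hX hY
    have := isHermitian_conjTranspose_mul_mul X hY
    rwa [hX.eq] at this
  have hRh : R.IsHermitian := hR.1
  -- Writing `tr (D S)` as the inner product of `Q S Q` and `Q⁻¹ D Q⁻¹`, this square is the
  -- arithmetic-geometric mean inequality with weight `c`.
  have k1 := trace_mul_self_re_nonneg
    (((herm hQh hS).smul (k := (c : ℂ)) (Complex.conj_ofReal c)).sub (herm hQi hD))
  -- The commutator of `R` and `S` has nonnegative Hilbert-Schmidt norm, hence `tr (R S R S) ≤ tr
  -- (R² S²)`; then `S² ≤ 1`.
  have k2 : (R * S * R * S).trace.re ≤ (R * R).trace.re := by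
    have e0 : (R * S - S * R)ᴴ = S * R - R * S := by
      rw [conjTranspose_sub, conjTranspose_mul, conjTranspose_mul, hRh.eq, hS.eq]
    have e1 := (Complex.le_def.mp
      (posSemidef_conjTranspose_mul_self (R * S - S * R)).trace_nonneg).1
    rw [e0] at e1
    have e2 : ((S * R - R * S) * (R * S - S * R)).trace =
        2 * (R * R * (S * S)).trace - 2 * (R * S * R * S).trace := by
      have a1 : (S * R * (R * S)).trace = (R * R * (S * S)).trace := by
        rw [mul_assoc, trace_mul_comm]; simp only [mul_assoc]
      have a2 : (S * R * (S * R)).trace = (R * S * R * S).trace := by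
        rw [mul_assoc, trace_mul_comm]; simp only [mul_assoc]
      have a3 : (R * S * (R * S)).trace = (R * S * R * S).trace := by simp only [mul_assoc]
      have a4 : (R * S * (S * R)).trace = (R * R * (S * S)).trace := by
        rw [← mul_assoc, trace_mul_comm]; simp only [mul_assoc]
      rw [sub_mul, mul_sub, mul_sub, trace_sub, trace_sub, trace_sub, a1, a2, a3, a4]
      ring
    have e3 : (R * R * (S * S)).trace.re ≤ (R * R).trace.re := by
      have hp : (R * R).PosSemidef := by
        have := posSemidef_conjTranspose_mul_self R
        rwa [hRh.eq] at this
      have : S * S ≤ 1 := by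
        rw [Matrix.le_iff]
        have q1 : (1 - S).PosSemidef := Matrix.le_iff.mp h2
        have q2 : (1 + S).PosSemidef := by
          have := Matrix.le_iff.mp h1
          rwa [sub_neg_eq_add, add_comm] at this
        have q3 := q2.conjTranspose_mul_mul_same (1 - S)
        have q4 := q1.conjTranspose_mul_mul_same (1 + S)
        rw [q1.1.eq] at q3
        rw [q2.1.eq] at q4
        have q5 := (q3.add q4).smul (show (0 : ℝ) ≤ 1 / 2 by norm_num)
        have q6 : (1 - S) * (1 + S) * (1 - S) + (1 + S) * (1 - S) * (1 + S) =
            (2 : ℝ) • (1 - S * S) := by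
          rw [two_smul]; noncomm_ring
        rw [q6, smul_smul] at q5
        norm_num at q5
        exact q5
      have := trace_mul_re_le hp this
      rwa [mul_one] at this
    rw [e2] at e1
    simp only [Complex.zero_re, Complex.sub_re, Complex.mul_re, Complex.re_ofNat,
      Complex.im_ofNat, zero_mul, sub_zero] at e1
    linarith
  have k3 : ((Q * S * Q) * (Q * S * Q)).trace = (R * S * R * S).trace := by
    have e1 : (Q * S * Q) * (Q * S * Q) = Q * (S * (Q * Q) * S * Q) := by simp only [mul_assoc]
    have e2 : S * (Q * Q) * S * Q * Q = S * ((Q * Q) * S * (Q * Q)) := by simp only [mul_assoc]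
    rw [e1, trace_mul_comm, e2, trace_mul_comm, hQQ]
  have k4 : ((Q⁻¹ * D * Q⁻¹) * (Q⁻¹ * D * Q⁻¹)).trace = (D * R⁻¹ * D * R⁻¹).trace := by
    rw [hRi]
    simp only [mul_assoc]
    rw [trace_mul_comm Q⁻¹]; simp only [mul_assoc]
  have k5 : ((Q * S * Q) * (Q⁻¹ * D * Q⁻¹)).trace = (D * S).trace := by
    have : (Q * S * Q) * (Q⁻¹ * D * Q⁻¹) = Q * (S * (Q * Q⁻¹) * D * Q⁻¹) := by
      simp only [mul_assoc]
    rw [this, c1, mul_one, trace_mul_comm, mul_assoc, mul_assoc, c2, mul_one, trace_mul_comm]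
  have k6 : ((Q⁻¹ * D * Q⁻¹) * (Q * S * Q)).trace = (D * S).trace := by
    rw [trace_mul_comm, k5]
  rw [sub_mul, mul_sub, mul_sub] at k1
  simp only [Matrix.smul_mul, Matrix.mul_smul, trace_sub, trace_smul, k3, k4, k5, k6, smul_eq_mul,
    Complex.sub_re, Complex.re_ofReal_mul] at k1
  have k7 : (D * S).trace.re ≤ c / 2 * (R * S * R * S).trace.re +
      1 / (2 * c) * (D * R⁻¹ * D * R⁻¹).trace.re := by
    have : c / 2 * (R * S * R * S).trace.re +
      1 / (2 * c) * (D * R⁻¹ * D * R⁻¹).trace.re - (D * S).trace.re = 1 / (2 * c) *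
        (c * (c * (R * S * R * S).trace.re) - c * (D * S).trace.re - (c * (D * S).trace.re -
          (D * R⁻¹ * D * R⁻¹).trace.re)) := by
      field_simp; ring
    have : 0 ≤ 1 / (2 * c) *
        (c * (c * (R * S * R * S).trace.re) - c * (D * S).trace.re - (c * (D * S).trace.re -
          (D * R⁻¹ * D * R⁻¹).trace.re)) := mul_nonneg (by positivity) k1
    linarith
  have := mul_le_mul_of_nonneg_left k2 (half_pos hc).le
  linarith

end Trace

/-! ### Block-diagonal operators and the hybrid argument. -/

section Blocks

variable {ι : Type} [Fintype ι] [DecidableEq ι]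

lemma traceNorm_smul (c : ℝ) (A : Matrix ι ι ℂ) : traceNorm (c • A) = |c| * traceNorm A := by
  have h1 : ∀ B : Matrix ι ι ℂ, CFC.sqrt (B.conjTranspose * B) = CFC.abs B := fun _ => rfl
  unfold traceNorm
  rw [h1, h1, CFC.abs_smul, trace_smul, Real.norm_eq_abs]
  simp

lemma traceNorm_zero : traceNorm (0 : Matrix ι ι ℂ) = 0 := by
  simpa using traceNorm_smul 0 (0 : Matrix ι ι ℂ)

omit [Fintype ι] [DecidableEq ι] in
lemma _root_.Matrix.IsHermitian.real_smul {A : Matrix ι ι ℂ} (hA : A.IsHermitian) (c : ℝ) :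
    (c • A).IsHermitian := by
  unfold Matrix.IsHermitian
  rw [conjTranspose_smul, hA.eq]
  simp

/-- The trace norm of a block-diagonal operator. -/
lemma traceNorm_blockDiagonal_le {κ : Type} [Fintype κ] [DecidableEq κ]
    {M : Matrix (κ × ι) (κ × ι) ℂ} {B : κ → Matrix ι ι ℂ} (hB : ∀ k, (B k).IsHermitian)
    (hM : ∀ k k' e e', M (k, e) (k', e') = if k = k' then B k e e' else 0) :
    traceNorm M ≤ ∑ k, traceNorm (B k) := by
  have hMh : M.IsHermitian := by
    ext ⟨k, e⟩ ⟨k', e'⟩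
    rw [conjTranspose_apply, hM, hM]
    by_cases h : k = k'
    · subst h; simpa using congrFun (congrFun (hB k) e) e'
    · simp [h, Ne.symm h]
  obtain ⟨S, h1, h2, h3⟩ := exists_trace_mul_eq_traceNorm hMh
  rw [← h3]
  have key : (M * S).trace = ∑ k, (B k * S.submatrix (Prod.mk k) (Prod.mk k)).trace := by
    simp only [trace, Matrix.diag, mul_apply, Fintype.sum_prod_type, submatrix_apply, hM]
    simp
  have hone : ∀ k : κ, (1 : Matrix (κ × ι) (κ × ι) ℂ).submatrix (Prod.mk k) (Prod.mk k) = 1 :=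
    fun k => submatrix_one _ fun a b h => (Prod.mk.inj h).2
  rw [key, Complex.re_sum]
  -- The diagonal blocks of the optimal `S` are admissible for the blocks of `M`.
  refine sum_le_sum fun k _ => trace_mul_le_traceNorm (hB k) ?_ ?_
  · rw [Matrix.le_iff] at h1 ⊢
    rw [← hone k]
    exact h1.submatrix (Prod.mk k)
  · rw [Matrix.le_iff] at h2 ⊢
    rw [← hone k]
    exact h2.submatrix (Prod.mk k)

variable {X : Type*} [Fintype X]

omit [Fintype ι] [DecidableEq ι] [Fintype X] in
lemma sum_fiber_isHermitian {A : X → Matrix ι ι ℂ} (hA : ∀ x, (A x).IsHermitian) (s : Finset X) :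
    (∑ x ∈ s, A x).IsHermitian := isSelfAdjoint_sum s fun x _ => hA x

/-- Refining a partition increases the sum of the trace norms. -/
lemma sum_traceNorm_fiber_le {P G : Type*} [Fintype P] [DecidableEq P] [Fintype G] [DecidableEq G]
    {A : X → Matrix ι ι ℂ} (hA : ∀ x, (A x).IsHermitian) (p : X → P) (g : X → G)
    (h : ∀ x x', g x = g x' → p x = p x') :
    ∑ z, traceNorm (∑ x with p x = z, A x) ≤ ∑ a, traceNorm (∑ x with g x = a, A x) := by
  have h1 : ∀ z, traceNorm (∑ x with p x = z, A x) ≤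
      ∑ a, traceNorm (∑ x with p x = z ∧ g x = a, A x) := by
    intro z
    have : ∑ x with p x = z, A x = ∑ a, ∑ x with p x = z ∧ g x = a, A x := by
      rw [← sum_fiberwise _ g]
      simp only [filter_filter]
    rw [this]
    exact traceNorm_sum_le _ _ fun a _ => sum_fiber_isHermitian hA _
  refine (sum_le_sum fun z _ => h1 z).trans ?_
  rw [sum_comm]
  refine sum_le_sum fun a _ => ?_
  by_cases hx : ∃ x, g x = a
  · obtain ⟨x₀, rfl⟩ := hx
    rw [sum_eq_single (p x₀)]
    · refine le_of_eq (congrArg _ (sum_congr (filter_congr fun x _ => ?_) fun _ _ => rfl))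
      exact ⟨fun hh => hh.2, fun hh => ⟨h _ _ hh, hh⟩⟩
    · intro z _ hz
      rw [filter_false_of_mem, sum_empty, traceNorm_zero]
      rintro x - ⟨rfl, h2⟩
      exact hz (h _ _ h2)
    · simp
  · push Not at hx
    simp [hx, traceNorm_zero]

/-- Hybrid argument: the distance of a sequence of bits from uniform is bounded by the distances of
the single bits given any information that determines the preceding ones. -/
lemma sum_traceNorm_sub_uniform_le {ρ : X → Matrix ι ι ℂ} (hρ : ∀ x, (ρ x).IsHermitian) (m : ℕ)
    (f : Fin m → X → Bool) (G : Fin m → Type) [∀ i, Fintype (G i)] [∀ i, DecidableEq (G i)]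
    (g : ∀ i, X → G i) (h : ∀ i j, j < i → ∀ x x', g i x = g i x' → f j x = f j x') :
    ∑ z : Fin m → Bool, traceNorm ((∑ x with (fun i => f i x) = z, ρ x) -
        (2 ^ m : ℝ)⁻¹ • ∑ x, ρ x) ≤
      ∑ i, ∑ a, traceNorm (∑ x with g i x = a, sgn (f i x) • ρ x) := by
  induction m with
  | zero =>
    refine le_of_eq ?_
    have : ∀ z : Fin 0 → Bool, (univ.filter fun x => (fun i => f i x) = z) = univ := fun z =>
      filter_true_of_mem fun x _ => Subsingleton.elim _ _
    simp [this, traceNorm_zero]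
  | succ m ih =>
    have ih' := ih (fun i => f i.castSucc) (fun i => G i.castSucc) (fun i => g i.castSucc)
      fun i j hij => h _ _ (Fin.castSucc_lt_castSucc_iff.mpr hij)
    rw [Fin.sum_univ_castSucc]
    set p : X → Fin m → Bool := fun x i => f i.castSucc x with hp
    set b : X → Bool := f (Fin.last m) with hb
    have hsgn : ∀ x, (sgn (b x) • ρ x).IsHermitian := fun x => (hρ x).real_smul _
    -- The indicator of `b x = c` is `(1 + sgn c * sgn (b x)) / 2`. The two values of `c` restore
    -- the factor one in front of both the old distance and the new bias.
    have split : ∀ z c, traceNorm ((∑ x with (fun i => f i x) = Fin.snoc (α := fun _ => Bool) z c,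
        ρ x) - (2 ^ (m + 1) : ℝ)⁻¹ • ∑ x, ρ x) ≤
        1 / 2 * traceNorm (∑ x with p x = z, sgn (b x) • ρ x) +
        1 / 2 * traceNorm ((∑ x with p x = z, ρ x) - (2 ^ m : ℝ)⁻¹ • ∑ x, ρ x) := by
      intro z c
      have e1 : ∀ x, (fun i => f i x) = Fin.snoc (α := fun _ => Bool) z c ↔ p x = z ∧ b x = c := by
        intro x
        constructor
        · intro hx
          refine ⟨funext fun i => ?_, ?_⟩
          · simpa using congrFun hx i.castSucc
          · simpa using congrFun hx (Fin.last m)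
        · rintro ⟨rfl, rfl⟩
          funext i
          refine Fin.lastCases ?_ (fun i => ?_) i <;> simp [hp, hb]
      have e2 : ∑ x with (fun i => f i x) = Fin.snoc (α := fun _ => Bool) z c, ρ x =
          (sgn c / 2) • (∑ x with p x = z, sgn (b x) • ρ x) +
            (1 / 2 : ℝ) • ∑ x with p x = z, ρ x := by
        simp only [e1]
        rw [← filter_filter, sum_filter, smul_sum, smul_sum, ← sum_add_distrib]
        refine sum_congr rfl fun x _ => ?_
        rw [smul_smul, ← add_smul]
        split_ifs with hx
        · rw [hx]; cases c <;> norm_num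
        · have : sgn c / 2 * sgn (b x) + 1 / 2 = 0 := by
            rcases Bool.eq_false_or_eq_true c with hc | hc <;>
              rcases Bool.eq_false_or_eq_true (b x) with hbx | hbx <;>
              first | exact absurd (hbx.trans hc.symm) hx | (rw [hc, hbx]; norm_num)
          rw [this, zero_smul]
      have e3 : (∑ x with (fun i => f i x) = Fin.snoc (α := fun _ => Bool) z c, ρ x) -
          (2 ^ (m + 1) : ℝ)⁻¹ • ∑ x, ρ x =
          (sgn c / 2) • (∑ x with p x = z, sgn (b x) • ρ x) +
            (1 / 2 : ℝ) • ((∑ x with p x = z, ρ x) - (2 ^ m : ℝ)⁻¹ • ∑ x, ρ x) := by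
        rw [e2, smul_sub, smul_smul, pow_succ, mul_inv, mul_comm (1 / 2 : ℝ), one_div]
        abel
      rw [e3]
      refine (traceNorm_add_le ((sum_fiber_isHermitian hsgn _).real_smul _)
        (((sum_fiber_isHermitian hρ _).sub
          ((sum_fiber_isHermitian hρ _).real_smul _)).real_smul _)).trans (le_of_eq ?_)
      rw [traceNorm_smul, traceNorm_smul, abs_div, abs_sgn]
      norm_num
    rw [← Equiv.sum_comp (Fin.snocEquiv fun _ => Bool), Fintype.sum_prod_type, Fintype.sum_bool,
      ← sum_add_distrib]
    calc _ ≤ ∑ z, (traceNorm ((∑ x with p x = z, ρ x) - (2 ^ m : ℝ)⁻¹ • ∑ x, ρ x) +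
          traceNorm (∑ x with p x = z, sgn (b x) • ρ x)) := by
          refine sum_le_sum fun z _ => ?_
          have h1 := split z true
          have h2 := split z false
          have h3 := add_le_add h1 h2
          refine h3.trans (le_of_eq (by ring))
      _ ≤ _ := by
          rw [sum_add_distrib]
          refine add_le_add ih' (sum_traceNorm_fiber_le hsgn p (g (Fin.last m)) fun x x' hx => ?_)
          exact funext fun i => h _ _ (Fin.castSucc_lt_last i) _ _ hx

end Blocks

/-! ### One-bit extractors with quantum side information. -/

/-- A one-bit extractor applied to a source of bounded, but not normalized, weights. -/
lemma IsStrongExtractor.sum_abs_le {n t : ℕ} {C : BitString n → BitString t → Bool} {k δ : ℝ}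
    (hC : IsStrongExtractor C k δ) (hδ : 0 ≤ δ) {w : BitString n → ℝ} (hw : ∀ x, 0 ≤ w x) {b : ℝ}
    (hb : ∀ x, w x ≤ b) :
    (2 ^ t : ℝ)⁻¹ * ∑ v, |∑ x, w x * sgn (C x v)| ≤ 2 * δ * ∑ x, w x + 2 ^ k * b := by
  set q := ∑ x, w x with hq
  have hq0 : 0 ≤ q := sum_nonneg fun x _ => hw x
  have hb0 : 0 ≤ b := (hw (fun _ => false)).trans (hb _)
  have h2k : (0 : ℝ) < 2 ^ k := by positivity
  have htriv : (2 ^ t : ℝ)⁻¹ * ∑ v, |∑ x, w x * sgn (C x v)| ≤ q := by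
    have h1 : ∀ v, |∑ x, w x * sgn (C x v)| ≤ q := fun v => by
      refine (abs_sum_le_sum_abs _ _).trans (le_of_eq (sum_congr rfl fun x _ => ?_))
      rw [abs_mul, abs_sgn, mul_one, abs_of_nonneg (hw x)]
    rw [inv_mul_le_iff₀ (by positivity)]
    refine (sum_le_sum fun v _ => h1 v).trans (le_of_eq ?_)
    simp
  -- If the total weight is at most `2 ^ k * b`, the trivial bound suffices. Otherwise the
  -- normalized source has min-entropy at least `k`.
  rcases le_or_gt q (2 ^ k * b) with hle | hlt
  · have : 0 ≤ 2 * δ * q := by positivity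
    linarith
  have hq1 : 0 < q := lt_of_le_of_lt (by positivity) hlt
  have hsum : ∑ x, w x / q = 1 := by rw [← sum_div, ← hq, div_self hq1.ne']
  have h1 := hC (fun x => w x / q) (fun x => div_nonneg (hw x) hq0) hsum
    (le_minEntropy (fun x => div_nonneg (hw x) hq0) hsum fun x => by
      rw [Real.rpow_neg (by norm_num), div_le_iff₀ hq1, inv_mul_eq_div, le_div_iff₀ h2k]
      have := mul_le_mul_of_nonneg_left (hb x) h2k.le
      linarith)
  rw [sum_abs_bool_eq _ _ hsum] at h1
  have h2 : ∀ v, |∑ x, w x / q * sgn (C x v)| = |∑ x, w x * sgn (C x v)| / q := by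
    intro v
    have : ∑ x, w x / q * sgn (C x v) = (∑ x, w x * sgn (C x v)) / q := by
      rw [sum_div]; exact sum_congr rfl fun x _ => by ring
    rw [this, abs_div, abs_of_pos hq1]
  simp only [h2] at h1
  rw [← sum_div, ← mul_div_assoc, ← mul_div_assoc, div_le_iff₀ hq1] at h1
  have : 0 ≤ 2 ^ k * b := by positivity
  linarith

section PGM

variable {ι : Type} [Fintype ι] [DecidableEq ι]

/-- One-bit extractors against quantum side information, by means of the pretty good
measurement. -/
lemma IsStrongExtractor.sum_traceNorm_le {n t : ℕ} {C : BitString n → BitString t → Bool}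
    {k δ : ℝ} (hC : IsStrongExtractor C k δ) (hδ : 0 ≤ δ) {ρ : BitString n → Matrix ι ι ℂ}
    (hρ : ∀ x, (ρ x).PosSemidef) {σ : Matrix ι ι ℂ} (hσ : IsState σ) {p : ℝ} (hp : 0 ≤ p)
    (hρσ : ∀ x, ρ x ≤ p • σ) {c η : ℝ} (hc : 0 < c) (hη : 0 < η) :
    (2 ^ t : ℝ)⁻¹ * ∑ v, traceNorm (∑ x, sgn (C x v) • ρ x) ≤
      c / 2 * (∑ x, (ρ x).trace.re + η) +
        1 / (2 * c) * (2 * δ * ∑ x, (ρ x).trace.re + 2 ^ k * p) := by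
  have hne : Nonempty ι := by
    by_contra h
    rw [not_nonempty_iff] at h
    have := hσ.2
    simp [trace] at this
  have hD : (0 : ℝ) < Fintype.card ι := by exact_mod_cast Fintype.card_pos
  -- The multiple of the identity makes `s` invertible and adds only `η` to its trace.
  set s : Matrix ι ι ℂ := ∑ x, ρ x + (η / Fintype.card ι) • 1 with hs
  have hsum : (∑ x, ρ x).PosSemidef := posSemidef_sum _ fun x _ => hρ x
  have hsp : s.PosDef := PosDef.posSemidef_add hsum (PosDef.one.smul (by positivity))
  set R := CFC.sqrt s with hR
  have hRR : R * R = s := CFC.sqrt_mul_sqrt_self s hsp.posSemidef.nonneg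
  have hRs : R.PosSemidef := (CFC.sqrt_nonneg s).posSemidef
  have hRdet : IsUnit R.det := by
    have := hsp.det_pos.ne'.isUnit
    rw [← hRR, det_mul] at this
    exact isUnit_of_mul_isUnit_left this
  have hRp : R.PosDef := hRs.posDef_iff_isUnit.mpr ((isUnit_iff_isUnit_det R).mpr hRdet)
  set T := R⁻¹ with hT
  have hTp : T.PosDef := hRp.inv
  have hTh : T.IsHermitian := hTp.1
  have hTs : T * s * T = 1 := by
    rw [← hRR, ← mul_assoc, mul_assoc, nonsing_inv_mul R hRdet, mul_nonsing_inv R hRdet, one_mul]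
  have hM : ∀ x, (T * ρ x * T).PosSemidef := fun x => by
    have := (hρ x).conjTranspose_mul_mul_same T
    rwa [hTh.eq] at this
  have hMsum : ∑ x, T * ρ x * T ≤ 1 := by
    rw [← sum_mul, ← mul_sum, Matrix.le_iff, ← hTs, ← sub_mul, ← mul_sub, hs, add_sub_cancel_left]
    have := ((PosSemidef.one (n := ι) (R := ℂ)).smul
      (show (0 : ℝ) ≤ η / Fintype.card ι by positivity)).conjTranspose_mul_mul_same T
    rwa [hTh.eq] at this
  have htr : (R * R).trace.re = ∑ x, (ρ x).trace.re + η := by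
    rw [hRR, hs, trace_add, trace_sum, trace_smul, trace_one, Complex.add_re, Complex.re_sum]
    simp
  -- The joint weight of source value `x` and outcome `x'` of the pretty good measurement, whose
  -- elements `T ρ_x' T` sum to at most one. For fixed `x'` this is a classical source.
  set P : BitString n → BitString n → ℝ := fun x x' => (ρ x * (T * ρ x' * T)).trace.re with hP
  have hP0 : ∀ x x', 0 ≤ P x x' := fun x x' => trace_mul_re_nonneg (hρ x) (hM x')
  have hPb : ∀ x x', P x x' ≤ p * (σ * (T * ρ x' * T)).trace.re := by
    intro x x'
    have := trace_mul_re_le (hM x') (hρσ x)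
    rw [trace_mul_comm, Matrix.mul_smul, trace_smul, trace_mul_comm _ σ] at this
    simpa [hP] using this
  have hquad : ∀ v, ((∑ x, sgn (C x v) • ρ x) * T * (∑ x, sgn (C x v) • ρ x) * T).trace.re =
      ∑ x', sgn (C x' v) * ∑ x, P x x' * sgn (C x v) := by
    intro v
    have e1 : (∑ x, sgn (C x v) • ρ x) * T * (∑ x, sgn (C x v) • ρ x) * T =
        ∑ x', ∑ x, (sgn (C x' v) * sgn (C x v)) • (ρ x * (T * ρ x' * T)) := by
      simp only [sum_mul, mul_sum, Matrix.smul_mul, Matrix.mul_smul, smul_smul, mul_assoc]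
    rw [e1, trace_sum, Complex.re_sum]
    refine sum_congr rfl fun x' _ => ?_
    rw [trace_sum, Complex.re_sum, mul_sum]
    refine sum_congr rfl fun x _ => ?_
    rw [trace_smul, Complex.smul_re, smul_eq_mul]
    ring
  have hstep : ∀ v, traceNorm (∑ x, sgn (C x v) • ρ x) ≤
      c / 2 * (∑ x, (ρ x).trace.re + η) +
        1 / (2 * c) * ∑ x', |∑ x, P x x' * sgn (C x v)| := by
    intro v
    have hh : (∑ x, sgn (C x v) • ρ x).IsHermitian := isSelfAdjoint_sum _ fun x _ => by
      have := (hρ x).1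
      rw [isSelfAdjoint_iff, star_smul, star_eq_conjTranspose, this.eq]; simp
    have h1 := traceNorm_le_of_sqrt hh hRp hc
    rw [htr, hquad] at h1
    refine h1.trans ?_
    gcongr with x'
    refine (le_abs_self _).trans (le_of_eq ?_)
    rw [abs_mul, abs_sgn, one_mul]
  have hcl : ∀ x', (2 ^ t : ℝ)⁻¹ * ∑ v, |∑ x, P x x' * sgn (C x v)| ≤
      2 * δ * ∑ x, P x x' + 2 ^ k * (p * (σ * (T * ρ x' * T)).trace.re) := fun x' =>
    hC.sum_abs_le hδ (fun x => hP0 x x') (fun x => hPb x x')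
  have hPs : ∑ x', ∑ x, P x x' ≤ ∑ x, (ρ x).trace.re := by
    rw [sum_comm]
    refine sum_le_sum fun x _ => ?_
    have := trace_mul_re_le (hρ x) hMsum
    rwa [mul_sum, trace_sum, Complex.re_sum, mul_one] at this
  have hσs : ∑ x', (σ * (T * ρ x' * T)).trace.re ≤ 1 := by
    have := trace_mul_re_le hσ.1 hMsum
    rw [mul_sum, trace_sum, Complex.re_sum, mul_one, hσ.2] at this
    simpa using this
  have hct : (2 ^ t : ℝ)⁻¹ * 2 ^ t = 1 := by field_simp
  calc (2 ^ t : ℝ)⁻¹ * ∑ v, traceNorm (∑ x, sgn (C x v) • ρ x)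
      ≤ (2 ^ t : ℝ)⁻¹ * ∑ v, (c / 2 * (∑ x, (ρ x).trace.re + η) +
        1 / (2 * c) * ∑ x', |∑ x, P x x' * sgn (C x v)|) := by
        gcongr with v; exact hstep v
    _ = c / 2 * (∑ x, (ρ x).trace.re + η) +
        1 / (2 * c) * ∑ x', (2 ^ t : ℝ)⁻¹ * ∑ v, |∑ x, P x x' * sgn (C x v)| := by
        rw [← mul_sum _ _ (2 ^ t : ℝ)⁻¹, sum_comm (s := (univ : Finset (BitString n))),
          sum_add_distrib, ← mul_sum _ _ (1 / (2 * c))]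
        simp only [sum_const, card_univ, Fintype.card_pi, Fintype.card_bool, prod_const,
          Fintype.card_fin, nsmul_eq_mul]
        push_cast
        linear_combination (c / 2 * (∑ x, (ρ x).trace.re + η)) * hct
    _ ≤ c / 2 * (∑ x, (ρ x).trace.re + η) +
        1 / (2 * c) * ∑ x', (2 * δ * ∑ x, P x x' +
          2 ^ k * (p * (σ * (T * ρ x' * T)).trace.re)) := by
        gcongr with x'; exact hcl x'
    _ = c / 2 * (∑ x, (ρ x).trace.re + η) + 1 / (2 * c) * (2 * δ * ∑ x', ∑ x, P x x' +
          2 ^ k * (p * ∑ x', (σ * (T * ρ x' * T)).trace.re)) := by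
        rw [sum_add_distrib, ← mul_sum, ← mul_sum, ← mul_sum]
    _ ≤ _ := by
        gcongr
        exact mul_le_of_le_one_right hp hσs

/-- One-bit extractors against quantum side information together with the value of a function of
the source. -/
lemma IsStrongExtractor.sum_sum_traceNorm_le {n t : ℕ} {C : BitString n → BitString t → Bool}
    {k δ : ℝ} (hC : IsStrongExtractor C k δ) (hδ : 0 ≤ δ) {ρ : BitString n → Matrix ι ι ℂ}
    (hρ : ∀ x, (ρ x).PosSemidef) {σ : Matrix ι ι ℂ} (hσ : IsState σ) {p : ℝ} (hp : 0 ≤ p)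
    (hρσ : ∀ x, ρ x ≤ p • σ) {c η : ℝ} (hc : 0 < c) (hη : 0 < η) {G : Type*} [Fintype G]
    [DecidableEq G] (g : BitString n → G) :
    ∑ v, ∑ a, traceNorm (∑ x with g x = a, sgn (C x v) • ρ x) ≤
      2 ^ t * (c / 2 * (∑ x, (ρ x).trace.re + Fintype.card G * η) +
        1 / (2 * c) * (2 * δ * ∑ x, (ρ x).trace.re + Fintype.card G * (2 ^ k * p))) := by
  have h1 : ∀ a, (2 ^ t : ℝ)⁻¹ * ∑ v, traceNorm (∑ x with g x = a, sgn (C x v) • ρ x) ≤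
      c / 2 * (∑ x with g x = a, (ρ x).trace.re + η) +
        1 / (2 * c) * (2 * δ * ∑ x with g x = a, (ρ x).trace.re + 2 ^ k * p) := by
    intro a
    -- Blocks outside the fibre are set to zero, which keeps the bound by `p • σ`. No normalization
    -- is needed, so each value `a` merely repeats the additive terms `η` and `2 ^ k * p`.
    have := hC.sum_traceNorm_le hδ (ρ := fun x => if g x = a then ρ x else 0)
      (fun x => by split_ifs; exacts [hρ x, PosSemidef.zero]) hσ hp
      (fun x => by
        split_ifs
        · exact hρσ x
        · exact (hσ.1.smul hp).nonneg) hc hη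
    have e1 : ∀ x, (if g x = a then ρ x else 0).trace.re =
        if g x = a then (ρ x).trace.re else 0 := by
      intro x; split_ifs <;> simp
    simpa only [smul_ite, smul_zero, e1, ← sum_filter] using this
  have h2 := sum_le_sum fun a (_ : a ∈ (univ : Finset G)) => h1 a
  rw [← mul_sum, inv_mul_le_iff₀ (by positivity), sum_comm] at h2
  refine h2.trans (le_of_eq ?_)
  congr 1
  simp only [sum_add_distrib, ← mul_sum, sum_fiberwise, sum_const, card_univ, nsmul_eq_mul]
  ring

end PGM

/-! ### Security of Trevisan's construction. -/

/-- Separation of the bits at the positions in `S` from the other ones. -/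
noncomputable def splitBits {d t : ℕ} (S : Finset (Fin d)) (h : S.card = t) :
    BitString d ≃ BitString t × ({k // k ∉ S} → Bool) :=
  (Equiv.piEquivPiSubtypeProd (· ∈ S) fun _ => Bool).trans
    (Equiv.prodCongr (Equiv.arrowCongr (S.orderIsoOfFin h).toEquiv.symm (Equiv.refl Bool))
      (Equiv.refl _))

lemma splitBits_fst {d t : ℕ} (S : Finset (Fin d)) (h : S.card = t) (y : BitString d) :
    (splitBits S h y).1 = restrictBits y S h := rfl

lemma splitBits_snd {d t : ℕ} (S : Finset (Fin d)) (h : S.card = t) (y : BitString d)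
    (k : {k // k ∉ S}) : (splitBits S h y).2 k = y k := rfl

section Trevisan

variable {n m d t : ℕ}

/-- The truth tables, as functions of the overlaps with `S i`, of the output bits before `i`. -/
abbrev Table (S : Fin m → Finset (Fin d)) (i : Fin m) : Type :=
  (j : {j // j < i}) → ({k // k ∈ S j ∩ S i} → Bool) → Bool

/-- The truth tables of the output bits before `i` for given source and seed outside of `S i`. -/
noncomputable def table (C : BitString n → BitString t → Bool) (S : Fin m → Finset (Fin d))
    (hS : ∀ i, (S i).card = t) (i : Fin m) (w : {k // k ∉ S i} → Bool) (x : BitString n) :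
    Table S i := fun j u =>
  C x (restrictBits (fun k => if hk : k ∈ S j ∩ S i then u ⟨k, hk⟩ else
    if hk' : k ∉ S i then w ⟨k, hk'⟩ else false) (S j) (hS j))

/-- The table has an entry for every setting of the seed on the overlap, so it determines bit `j`
without reference to the seed inside `S i`. The default `false` in `table` is never read: a position
of `S j` is in the overlap or outside `S i`. -/
lemma trevisan_eq_of_table_eq (C : BitString n → BitString t → Bool) (S : Fin m → Finset (Fin d))
    (hS : ∀ i, (S i).card = t) {i j : Fin m} (hij : j < i) (y : BitString d) {x x' : BitString n}
    (h : table C S hS i (splitBits (S i) (hS i) y).2 x =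
      table C S hS i (splitBits (S i) (hS i) y).2 x') :
    trevisan C S hS x y j = trevisan C S hS x' y j := by
  have key : ∀ x, table C S hS i (splitBits (S i) (hS i) y).2 x ⟨j, hij⟩ (fun k => y k) =
      trevisan C S hS x y j := by
    intro x
    unfold table trevisan
    congr 1
    funext k
    unfold restrictBits
    beta_reduce
    by_cases h1 : (S j).orderEmbOfFin (hS j) k ∈ S j ∩ S i
    · rw [dif_pos h1]
    · rw [dif_neg h1, dif_pos fun h2 => h1 (mem_inter.mpr ⟨orderEmbOfFin_mem _ (hS j) k, h2⟩),
        splitBits_snd]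
  rw [← key, ← key, h]

/-- A table has `∑ j < i, 2 ^ |S j ∩ S i|` bits, which is precisely the quantity bounded by a weak
design. -/
lemma card_table_le {S : Fin m → Finset (Fin d)} {r : ℝ} (hS : IsWeakDesign S t r) (i : Fin m) :
    (Fintype.card (Table S i) : ℝ) ≤ 2 ^ (r * m) := by
  have : (Fintype.card (Table S i) : ℝ) =
      2 ^ (∑ j with j < i, (2 : ℝ) ^ (S j ∩ S i).card) := by
    simp only [Fintype.card_pi, Fintype.card_bool, prod_const, card_univ, Fintype.card_coe]
    rw [prod_pow_eq_pow_sum, ← sum_subtype_eq_sum_filter]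
    push_cast
    rw [← Real.rpow_natCast]
    congr 1
    push_cast
    refine (sum_bij (fun j _ => j) (fun j _ => ?_) (fun _ _ _ _ h => h) (fun j _ => ⟨j, ?_, rfl⟩)
      fun _ _ => rfl)
    · simp
    · exact mem_univ _
  rw [this]
  exact Real.rpow_le_rpow_of_exponent_le (by norm_num) (hS.overlap i)

section Blocks

variable {E : Type} [Fintype E] [DecidableEq E]

/-- The error of an extractor in terms of the blocks of the state of source and side
information. -/
lemma extractionError_le (Ext : BitString n → BitString d → BitString m)
    {ρ : Matrix (BitString n × E) (BitString n × E) ℂ} {ρb : BitString n → Matrix E E ℂ}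
    (hb : ∀ x, ρb x = ρ.submatrix (Prod.mk x) (Prod.mk x)) (hρ : ∀ x, (ρb x).IsHermitian) :
    extractionError Ext ρ ≤ 1 / 2 * ((2 ^ d : ℝ)⁻¹ * ∑ y, ∑ z : BitString m,
      traceNorm ((∑ x with Ext x y = z, ρb x) - (2 ^ m : ℝ)⁻¹ • ∑ x, ρb x)) := by
  unfold extractionError
  refine mul_le_mul_of_nonneg_left ?_ (by norm_num)
  have hh : ∀ (y : BitString d) (z : BitString m),
      ((∑ x with Ext x y = z, ρb x) - (2 ^ m : ℝ)⁻¹ • ∑ x, ρb x).IsHermitian := fun y z =>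
    (sum_fiber_isHermitian hρ _).sub ((sum_fiber_isHermitian hρ _).real_smul _)
  refine (traceNorm_blockDiagonal_le (B := fun k : BitString m × BitString d => (2 ^ d : ℝ)⁻¹ •
      ((∑ x with Ext x k.2 = k.1, ρb x) - (2 ^ m : ℝ)⁻¹ • ∑ x, ρb x))
    (fun k => (hh _ _).real_smul _) ?_).trans (le_of_eq ?_)
  · rintro ⟨z, y⟩ ⟨z', y'⟩ e e'
    simp only [Matrix.sub_apply, outputState, of_apply, kroneckerMap_apply, mixedState,
      Matrix.smul_apply, reducedSnd, hb, Matrix.sum_apply, submatrix_apply, one_apply, smul_eq_mul, Prod.mk.injEq,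
      Fintype.card_pi, Fintype.card_bool, prod_const, card_univ, Fintype.card_fin, Complex.real_smul]
    by_cases h1 : z = z'
    · by_cases h2 : y = y'
      · subst h1 h2
        simp only [and_self, if_true]
        push_cast
        ring
      · simp [h2]
    · simp [h1]
  · rw [Fintype.sum_prod_type, sum_comm, mul_sum]
    refine sum_congr rfl fun y _ => ?_
    rw [mul_sum]
    refine sum_congr rfl fun z _ => ?_
    rw [traceNorm_smul, abs_of_nonneg (by positivity)]

/-- Trevisan's construction against side information with a bound on the blocks of the state. -/
lemma extractionError_trevisan_le {C : BitString n → BitString t → Bool} {k δ r v : ℝ}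
    (hC : IsStrongExtractor C k δ) (hδ : 0 < δ) {S : Fin m → Finset (Fin d)}
    (hS : IsWeakDesign S t r) {ρ : Matrix (BitString n × E) (BitString n × E) ℂ} (hρ : IsState ρ)
    {σ : Matrix E E ℂ} (hσ : IsState σ)
    (hρσ : ρ ≤ (2 : ℝ) ^ (-v) • ((1 : Matrix (BitString n) (BitString n) ℂ) ⊗ₖ σ))
    (hv : (2 : ℝ) ^ (k + r * m - v) ≤ 9 * δ) :
    extractionError (trevisan C S hS.card_eq) ρ ≤ 3 * m * √δ := by
  set ρb : BitString n → Matrix E E ℂ := fun x => ρ.submatrix (Prod.mk x) (Prod.mk x) with hb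
  have hpsd : ∀ x, (ρb x).PosSemidef := fun x => hρ.1.submatrix _
  have hle : ∀ x, ρb x ≤ (2 : ℝ) ^ (-v) • σ := by
    intro x
    rw [Matrix.le_iff] at hρσ ⊢
    convert hρσ.submatrix (Prod.mk x) using 1
    ext e e'
    simp [hb]
  have htr : ∑ x, (ρb x).trace.re = 1 := by
    have h1 : ρ.trace = ∑ x, (ρb x).trace := by
      simp [trace, hb, Fintype.sum_prod_type]
    rw [← Complex.re_sum, ← h1, hρ.2, Complex.one_re]
  have hsq : 0 < √δ := Real.sqrt_pos.mpr hδ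
  have hbit : ∀ i, ∑ y : BitString d, ∑ a, traceNorm
      (∑ x with table C S hS.card_eq i (splitBits (S i) (hS.card_eq i) y).2 x = a,
        sgn (trevisan C S hS.card_eq x y i) • ρb x) ≤ 2 ^ d * (19 / 4 * √δ) := by
    intro i
    have hG := card_table_le hS i
    have hG0 : (0 : ℝ) ≤ Fintype.card (Table S i) := by positivity
    have hrm : (0 : ℝ) < 2 ^ (r * m) := by positivity
    have hw : ∀ w : {k // k ∉ S i} → Bool, ∑ u : BitString t, ∑ a, traceNorm
        (∑ x with table C S hS.card_eq i w x = a, sgn (C x u) • ρb x) ≤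
          2 ^ t * (19 / 4 * √δ) := by
      intro w
      -- The value of `η` keeps the regularization, summed over all tables, at most one. With `c =
      -- 2√δ` the two terms are `2√δ` and `11/4 √δ`; after the factor `1/2` for trace distance,
      -- `19/8` is below the claimed `3`.
      refine (hC.sum_sum_traceNorm_le hδ.le hpsd hσ (by positivity) hle
        (c := 2 * √δ) (η := (2 ^ (r * m))⁻¹) (by positivity) (by positivity) _).trans ?_
      refine mul_le_mul_of_nonneg_left ?_ (by positivity)
      rw [htr]
      have h1 : (Fintype.card (Table S i) : ℝ) * (2 ^ (r * m))⁻¹ ≤ 1 := by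
        rw [← div_eq_mul_inv, div_le_one hrm]; exact hG
      have h2 : (Fintype.card (Table S i) : ℝ) * (2 ^ k * 2 ^ (-v)) ≤ 9 * δ := by
        refine le_trans (mul_le_mul_of_nonneg_right hG (by positivity)) (le_trans (le_of_eq ?_) hv)
        rw [← Real.rpow_add (by norm_num), ← Real.rpow_add (by norm_num)]
        congr 1; ring
      calc 2 * √δ / 2 * (1 + Fintype.card (Table S i) * (2 ^ (r * m))⁻¹) + 1 / (2 * (2 * √δ)) *
            (2 * δ * 1 + Fintype.card (Table S i) * (2 ^ k * 2 ^ (-v)))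
          ≤ 2 * √δ / 2 * (1 + 1) + 1 / (2 * (2 * √δ)) * (2 * δ * 1 + 9 * δ) := by gcongr
        _ = 19 / 4 * √δ := by
          field_simp
          rw [Real.sq_sqrt hδ.le]; ring
    have hcard : (2 : ℝ) ^ d = Fintype.card ({k // k ∉ S i} → Bool) * 2 ^ t := by
      have := Fintype.card_congr (splitBits (S i) (hS.card_eq i))
      rw [Fintype.card_prod, mul_comm] at this
      have h2 : ∀ l, Fintype.card (BitString l) = 2 ^ l := fun l => by simp
      rw [h2, h2] at this
      exact_mod_cast this
    rw [← Equiv.sum_comp (splitBits (S i) (hS.card_eq i)).symm, Fintype.sum_prod_type, sum_comm,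
      hcard, mul_assoc]
    refine le_trans (sum_le_card_nsmul univ _ (2 ^ t * (19 / 4 * √δ)) fun w _ => ?_)
      (by rw [nsmul_eq_mul, card_univ])
    refine le_trans (le_of_eq (sum_congr rfl fun u _ => ?_)) (hw w)
    have e1 : ∀ x, trevisan C S hS.card_eq x ((splitBits (S i) (hS.card_eq i)).symm (u, w)) i =
        C x u := by
      intro x
      unfold trevisan
      rw [← splitBits_fst, Equiv.apply_symm_apply]
    simp only [e1, Equiv.apply_symm_apply]
  refine (extractionError_le _ (fun x => rfl) fun x => (hpsd x).1).trans ?_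
  have hhyb : ∀ y : BitString d, ∑ z : BitString m, traceNorm
      ((∑ x with trevisan C S hS.card_eq x y = z, ρb x) - (2 ^ m : ℝ)⁻¹ • ∑ x, ρb x) ≤
      ∑ i, ∑ a, traceNorm
        (∑ x with table C S hS.card_eq i (splitBits (S i) (hS.card_eq i) y).2 x = a,
          sgn (trevisan C S hS.card_eq x y i) • ρb x) := fun y =>
    sum_traceNorm_sub_uniform_le (fun x => (hpsd x).1) m (fun i x => trevisan C S hS.card_eq x y i)
      (fun i => Table S i) (fun i x => table C S hS.card_eq i (splitBits (S i) (hS.card_eq i) y).2 x)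
      fun i j hij x x' h => trevisan_eq_of_table_eq C S hS.card_eq hij y h
  have h1 := (sum_le_sum fun y (_ : y ∈ (univ : Finset (BitString d))) => hhyb y).trans
    (le_of_eq sum_comm)
  have h2 := h1.trans (sum_le_card_nsmul univ _ _ fun i _ => hbit i)
  rw [nsmul_eq_mul, card_univ, Fintype.card_fin] at h2
  have h3 := mul_le_mul_of_nonneg_left h2 (show (0 : ℝ) ≤ (2 ^ d : ℝ)⁻¹ by positivity)
  have h4 : (2 ^ d : ℝ)⁻¹ * (m * (2 ^ d * (19 / 4 * √δ))) = m * (19 / 4 * √δ) := by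
    field_simp
  rw [h4] at h3
  have h5 : (0 : ℝ) ≤ m * √δ := by positivity
  linarith

end Blocks

end Trevisan

/-! ### Choice of parameters and assembly. -/

/-- Local one-bit extractors with logarithmic seed exist for every constant entropy rate. -/
lemma exists_isLocalOneBitExtractor {γ : ℝ} (hγ0 : 0 < γ) (hγ1 : γ < 1) :
    ∃ c₀ > (0 : ℝ), ∃ A₀ > (0 : ℝ), ∀ A ≥ A₀, ∀ (n : ℕ) (δ : ℝ), Real.exp (-(c₀ * n)) < δ →
      δ ≤ 1 / 36 → ∃ (t : ℕ) (C : BitString n → BitString t → Bool),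
        IsLocalOneBitExtractor C A γ δ := by
  -- Chosen so that `(1 + q) ^ n = 2 ^ (γ n / 4)`, while `τ` below gives `q ^ (τ n) = 2 ^ (-γ n /
  -- 4)`. Strings of weight below `τ n` then number at most `2 ^ (γ n / 2)`, and against min-entropy
  -- `γ n` their mass is at most `(2 ^ (-γ n / 4)) ^ 2 ≤ δ ^ 2`, by the choice of `c₀`.
  set q : ℝ := 2 ^ (γ / 4) - 1 with hq
  have hq0 : 0 < q := by
    have := Real.one_lt_rpow (x := 2) (by norm_num) (show 0 < γ / 4 by positivity)
    linarith
  have hq1 : q < 1 := by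
    have := Real.rpow_lt_rpow_of_exponent_lt (x := 2) (by norm_num) (show γ / 4 < 1 by linarith)
    rw [Real.rpow_one] at this
    linarith
  set e : ℝ := Real.logb 2 (1 / q) with he
  have he0 : 0 < e := Real.logb_pos (by norm_num) (by rw [lt_div_iff₀ hq0]; linarith)
  have hqe : q = 2 ^ (-e) := by
    rw [he, one_div, Real.logb_inv, neg_neg, Real.rpow_logb (by norm_num) (by norm_num) hq0]
  set τ : ℝ := γ / 4 / e with hτ
  have hτ0 : 0 < τ := by positivity
  have hlog2 : 0 < Real.log 2 := Real.log_pos (by norm_num)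
  refine ⟨γ / 4 * Real.log 2, by positivity, 3 / τ + 6, by positivity, fun A hA n δ hδn hδ => ?_⟩
  have hδ0 : 0 < δ := (Real.exp_pos _).trans hδn
  have hn : 0 < n := by
    rcases Nat.eq_zero_or_pos n with rfl | h
    · norm_num at hδn; linarith
    · exact h
  have hn1 : (1 : ℝ) ≤ n := by exact_mod_cast hn
  have hexp : Real.exp (-(γ / 4 * Real.log 2 * n)) = 2 ^ (-(γ / 4 * n)) := by
    rw [Real.rpow_def_of_pos (by norm_num)]; congr 1; ring
  rw [hexp] at hδn
  have h36 : 36 ≤ 1 / δ := by rw [le_div_iff₀ hδ0]; linarith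
  set a := Real.logb 2 (1 / δ) with ha
  have ha5 : 5 ≤ a := by
    rw [ha, Real.le_logb_iff_rpow_le (by norm_num) (by positivity)]
    norm_num at h36 ⊢; linarith
  set L := Real.logb 2 (n / δ) with hL
  have haL : a ≤ L := by
    rw [ha, hL]
    refine Real.logb_le_logb_of_le (by norm_num) (by positivity) ?_
    gcongr
  have hlna : Real.log (1 / δ) ≤ a := by
    have h1 : a = Real.log (1 / δ) / Real.log 2 := rfl
    rw [h1, le_div_iff₀ hlog2]
    have h2 : 0 ≤ Real.log (1 / δ) := Real.log_nonneg (by linarith)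
    nlinarith [Real.log_two_lt_d9]
  -- This makes the mean bias at most `δ ^ 3 ≤ δ ^ 2 / 2`; `t` gives `2 ^ t ≥ (n / δ) ^ 5`, enough
  -- for the union bound with `η = δ ^ 2`.
  set l := ⌈3 * Real.log (1 / δ) / τ⌉₊ with hl
  set t := ⌈5 * L⌉₊ with ht
  have hl1 : 3 * Real.log (1 / δ) / τ ≤ l := Nat.le_ceil _
  have hl2 : (l : ℝ) < 3 * Real.log (1 / δ) / τ + 1 :=
    Nat.ceil_lt_add_one (div_nonneg (mul_nonneg (by norm_num) (Real.log_nonneg (by linarith)))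
      hτ0.le)
  have ht1 : 5 * L ≤ t := Nat.le_ceil _
  have ht2 : (t : ℝ) < 5 * L + 1 := Nat.ceil_lt_add_one (by linarith)
  have hvexp : Real.exp (-(τ * l)) ≤ δ ^ 2 / 2 := by
    have h1 : 3 * Real.log (1 / δ) ≤ τ * l := by
      rw [div_le_iff₀ hτ0] at hl1; linarith
    calc Real.exp (-(τ * l)) ≤ Real.exp (-(3 * Real.log (1 / δ))) := by gcongr
      _ = δ ^ 3 := by
        rw [one_div, Real.log_inv, mul_neg, neg_neg, mul_comm, Real.exp_mul, Real.exp_log hδ0]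
        norm_cast
      _ ≤ δ ^ 2 / 2 := by nlinarith [sq_nonneg δ]
  have hvt : 16 * (n : ℝ) ≤ 2 ^ t * (δ ^ 2) ^ 2 := by
    have h1 : ((n : ℝ) / δ) ^ 5 ≤ 2 ^ t := by
      have h2 : (2 : ℝ) ^ L = n / δ := Real.rpow_logb (by norm_num) (by norm_num) (by positivity)
      rw [← h2, ← Real.rpow_natCast, ← Real.rpow_natCast, ← Real.rpow_mul (by norm_num)]
      refine Real.rpow_le_rpow_of_exponent_le (by norm_num) ?_
      push_cast; linarith
    calc 16 * (n : ℝ) ≤ (1 / δ) * n ^ 5 := by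
          gcongr
          · linarith
          · exact le_self_pow₀ hn1 (by norm_num)
      _ = ((n : ℝ) / δ) ^ 5 * (δ ^ 2) ^ 2 := by field_simp
      _ ≤ _ := by gcongr
  obtain ⟨v, hv⟩ := exists_parity_sample (l := l) (t := t) hn (τ := τ) (η := δ ^ 2)
    (by positivity) (pow_le_one₀ hδ0.le (by linarith)) hvexp hvt
  have hvol : (((univ : Finset (BitString n)).filter fun z => (weight z : ℝ) < τ * n).card : ℝ) *
      2 ^ (-(γ * n)) ≤ δ ^ 2 := by
    have h1 := card_weight_lt_le (n := n) (τ := τ) hq0 hq1.le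
    have h2 : q ^ (τ * n) = 2 ^ (-(γ / 4 * n)) := by
      rw [hqe, ← Real.rpow_mul (by norm_num)]
      congr 1
      rw [hτ]; field_simp
    have h3 : (1 + q) ^ n = 2 ^ (γ / 4 * n) := by
      rw [hq, add_sub_cancel, Real.rpow_mul (by norm_num), Real.rpow_natCast]
    rw [h2, h3, Real.rpow_neg (by norm_num), ← div_eq_mul_inv, div_le_iff₀ (by positivity)] at h1
    have h4 : ((2 : ℝ) ^ (-(γ / 4 * n))) ^ 2 ≤ δ ^ 2 := by gcongr
    refine le_trans ?_ h4
    calc _ ≤ (2 : ℝ) ^ (γ / 4 * n) * 2 ^ (γ / 4 * n) * 2 ^ (-(γ * n)) := by gcongr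
      _ = _ := by
        rw [sq, ← Real.rpow_add (by norm_num), ← Real.rpow_add (by norm_num),
          ← Real.rpow_add (by norm_num)]
        congr 1; ring
  refine ⟨t, fun x y => parity x (v y), ?_, ⟨l, ?_, isLocal_parity v⟩,
    isStrongExtractor_parity hδ0 v hv hvol⟩
  · have h1 : 0 < 3 / τ := by positivity
    have : 6 * L ≤ A * L := mul_le_mul_of_nonneg_right (by linarith) (by linarith)
    linarith
  · have h1 : 3 * Real.log (1 / δ) / τ ≤ 3 / τ * a := by
      rw [mul_div_right_comm]; gcongr
    have : (3 / τ + 6) * a ≤ A * a := by gcongr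
    linarith

lemma isLocal_trevisan_apply {n m d t l : ℕ} {C : BitString n → BitString t → Bool}
    (hC : IsLocal l C) (S : Fin m → Finset (Fin d)) (hS : ∀ i, (S i).card = t) (i : Fin m) :
    IsLocal l fun x y => trevisan C S hS x y i :=
  fun y => hC (restrictBits y (S i) (hS i))

lemma isLocal_trevisan {n m d t l : ℕ} {C : BitString n → BitString t → Bool}
    (hC : IsLocal l C) (S : Fin m → Finset (Fin d)) (hS : ∀ i, (S i).card = t) :
    IsLocal (m * l) (trevisan C S hS) := by
  intro y
  choose T hT using fun i => isLocal_trevisan_apply hC S hS i y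
  refine ⟨univ.biUnion T, ?_, fun x x' h => funext fun i => (hT i).2 x x' fun k hk =>
    h k (mem_biUnion.mpr ⟨i, mem_univ i, hk⟩)⟩
  simpa using card_biUnion_le_card_mul univ T l fun i _ => (hT i).1

/-- Trevisan's construction from a one-bit extractor and a weak design is quantum-proof. -/
lemma isQuantumProof_trevisan {n m d t : ℕ} {C : BitString n → BitString t → Bool}
    {k r ε δ K : ℝ} (hk : 0 ≤ k) (hr : 0 ≤ r) (hε : 0 < ε) (hmε : 2 * ε ≤ m)
    (hδ : δ = ε ^ 2 / (9 * (m : ℝ) ^ 2)) (hK : 1 ≤ K) (hC : IsStrongExtractor C k δ)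
    {S : Fin m → Finset (Fin d)} (hS : IsWeakDesign S t r) :
    IsQuantumProof (trevisan C S hS.card_eq)
      (k + r * m + 2 * Real.logb 2 m + 2 * Real.logb 2 (1 / ε) + K) ε := by
  intro E _ _ ρ hρ _ hmin
  have hm : (0 : ℝ) < m := by linarith
  have hδ0 : 0 < δ := by rw [hδ]; positivity
  set u := Real.logb 2 (m / ε) with hu
  have hu1 : 1 ≤ u := by
    rw [hu, Real.le_logb_iff_rpow_le (by norm_num) (by positivity), Real.rpow_one,
      le_div_iff₀ hε]
    exact hmε
  have hsplit : Real.logb 2 m + Real.logb 2 (1 / ε) = u := by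
    rw [hu, ← Real.logb_mul hm.ne' (by positivity), mul_one_div]
  have hrm : 0 ≤ r * m := by positivity
  have hlt : k + r * m + 2 * u < condMinEntropy ρ := by linarith
  unfold condMinEntropy at hlt
  -- The slack `K ≥ 1` makes the inequality strict, so the supremum need not be attained. An empty
  -- set would have supremum zero, contradicting `hlt`.
  obtain ⟨v, ⟨σ, hσ, hρσ⟩, hv⟩ := exists_lt_of_lt_csSup (by
    by_contra hne
    rw [Set.not_nonempty_iff_eq_empty] at hne
    rw [hne, Real.sSup_empty] at hlt
    linarith) hlt
  have h9 : (2 : ℝ) ^ (-(2 * u)) = 9 * δ := by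
    rw [mul_comm, ← neg_mul, Real.rpow_mul (by norm_num), Real.rpow_neg (by norm_num), hu,
      Real.rpow_logb (by norm_num) (by norm_num) (by positivity), hδ]
    norm_cast
    push_cast
    field_simp
  refine (extractionError_trevisan_le hC hδ0 hS hρ hσ hρσ ?_).trans (le_of_eq ?_)
  · rw [← h9]
    exact Real.rpow_le_rpow_of_exponent_le (by norm_num) (by linarith)
  · have : δ = (ε / (3 * m)) ^ 2 := by rw [hδ]; ring
    rw [this, Real.sqrt_sq (by positivity)]
    field_simp

lemma logb_nine_le : Real.logb 2 9 ≤ 4 := by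
  rw [Real.logb_le_iff_le_rpow (by norm_num) (by norm_num)]
  norm_num

end QExt

theorem mainTheorem6 (α γ r : ℝ) (hγ : 0 < γ) (hγα : γ < α) (hα : α ≤ 1) (hr : 1 < r) :
    ∃ c₀ > (0 : ℝ), ∃ A₀ > (0 : ℝ), ∃ B₀ > (0 : ℝ), ∀ A ≥ A₀, ∀ B ≥ B₀, ∃ K > (0 : ℝ),
      ∀ (n m : ℕ) (ε δ : ℝ), 0 < ε → ε ≤ 1 → 2 * ε ≤ m → δ = ε ^ 2 / (9 * (m : ℝ) ^ 2) →
        -- the one-bit extractors and the weak designs exist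
        (Real.exp (-(c₀ * n)) < δ →
          ∃ (t : ℕ) (C : QExt.BitString n → QExt.BitString t → Bool)
            (d : ℕ) (S : Fin m → Finset (Fin d)),
          QExt.IsLocalOneBitExtractor C A γ δ ∧
            QExt.IsWeakDesign S t r ∧ (d : ℝ) ≤ B * (t : ℝ) ^ 2) ∧
        -- and any of them can be combined
        (∀ (t : ℕ) (C : QExt.BitString n → QExt.BitString t → Bool)
            (d : ℕ) (S : Fin m → Finset (Fin d)) (_ : QExt.IsLocalOneBitExtractor C A γ δ)
            (hS : QExt.IsWeakDesign S t r) (_ : (d : ℝ) ≤ B * (t : ℝ) ^ 2),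
          -- the quantum-proof strong extractor
          QExt.IsQuantumProof (QExt.trevisan C S hS.card_eq)
            (γ * n + r * m + 2 * Real.logb 2 m + 2 * Real.logb 2 (1 / ε) + K) ε ∧
          -- in particular, extraction from sources of min-entropy `α n`
          (γ * n + r * m + 2 * Real.logb 2 m + 2 * Real.logb 2 (1 / ε) + K ≤ α * n →
            ∀ (E : Type) [Fintype E] [DecidableEq E]
              (ρ : Matrix (QExt.BitString n × E) (QExt.BitString n × E) ℂ),
              QExt.IsState ρ → QExt.IsClassicalOnFst ρ → QExt.condMinEntropy ρ = α * n →
                QExt.extractionError (QExt.trevisan C S hS.card_eq) ρ ≤ ε) ∧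
          -- seed length
          (m ≤ n → (d : ℝ) ≤ K * Real.logb 2 (n / ε) ^ 2) ∧
          -- locality of the whole output
          (∃ ℓ : ℕ, (ℓ : ℝ) ≤ K * (m * Real.logb 2 (m / ε)) ∧
            QExt.IsLocal ℓ (QExt.trevisan C S hS.card_eq)) ∧
          -- locality of each output bit
          (∃ ℓ : ℕ, (ℓ : ℝ) ≤ K * Real.logb 2 (m / ε) ∧
            ∀ i : Fin m, QExt.IsLocal ℓ fun x y => QExt.trevisan C S hS.card_eq x y i)) := by
  obtain ⟨c₀, hc₀, A₀, hA₀, hext⟩ := QExt.exists_isLocalOneBitExtractor hγ (hγα.trans_le hα)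
  have hlogr : 0 < Real.log r := Real.log_pos hr
  -- In `K`, the `1` is the entropy slack, `49 * (B * A ^ 2)` covers the seed via `log (n / δ) ≤ 7
  -- log (n / ε)`, and `6 * A` covers locality via `log (1 / δ) ≤ 6 log (m / ε)`.
  refine ⟨c₀, hc₀, A₀, hA₀, 1 / Real.log r + 1, by positivity, fun A hA B hB =>
    ⟨1 + 49 * (B * A ^ 2) + 6 * A, ?_, fun n m ε δ hε hε1 hmε hδ => ?_⟩⟩
  · have : 0 < A := hA₀.trans_le hA
    have : 0 < B := lt_of_lt_of_le (by positivity) hB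
    positivity
  have hA0 : 0 < A := hA₀.trans_le hA
  have hB0 : 0 < B := lt_of_lt_of_le (by positivity) hB
  have hBA : 0 < B * A ^ 2 := by positivity
  have hm : (0 : ℝ) < m := by linarith
  have hm1 : (1 : ℝ) ≤ m := by exact_mod_cast Nat.pos_of_ne_zero fun h => by simp [h] at hm
  have hδ0 : 0 < δ := by rw [hδ]; positivity
  have hδ9 : 1 / δ = 9 * (m / ε) ^ 2 := by rw [hδ]; field_simp
  have hme : 2 ≤ m / ε := by rw [le_div_iff₀ hε]; exact hmε
  set u := Real.logb 2 (m / ε) with hu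
  have hu1 : 1 ≤ u := by
    rw [hu, Real.le_logb_iff_rpow_le (by norm_num) (by positivity), Real.rpow_one]
    exact hme
  have hlogδ : Real.logb 2 (1 / δ) ≤ 6 * u := by
    rw [hδ9, Real.logb_mul (by norm_num) (by positivity), Real.logb_pow]
    push_cast
    linarith [QExt.logb_nine_le]
  refine ⟨fun hδn => ?_, fun t C d S hC hS hd => ?_⟩
  · obtain ⟨t, C, hC⟩ := hext A hA n δ hδn (by
      rw [le_div_iff₀ (by norm_num), ← le_div_iff₀' hδ0, hδ9]
      nlinarith)
    obtain ⟨d, S, hS, hd⟩ := QExt.exists_isWeakDesign hr t m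
    exact ⟨t, C, d, S, hC, hS, hd.trans (by gcongr)⟩
  obtain ⟨l, hl, hloc⟩ := hC.isLocal
  have hl6 : (l : ℝ) ≤ 6 * A * u := by
    have := mul_le_mul_of_nonneg_left hlogδ hA0.le
    linarith
  have hlK : 6 * A * u ≤ (1 + 49 * (B * A ^ 2) + 6 * A) * u := by gcongr; linarith
  have hq : QExt.IsQuantumProof (QExt.trevisan C S hS.card_eq)
      (γ * n + r * m + 2 * Real.logb 2 m + 2 * Real.logb 2 (1 / ε) +
        (1 + 49 * (B * A ^ 2) + 6 * A)) ε :=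
    QExt.isQuantumProof_trevisan (by positivity) (by linarith) hε hmε hδ (by linarith) hC.strong hS
  refine ⟨hq, fun hK E _ _ ρ hρ hcl hmin => hq E ρ hρ hcl (hmin ▸ hK), fun hmn => ?_,
    ⟨m * l, ?_, QExt.isLocal_trevisan hloc S hS.card_eq⟩,
    ⟨l, hl6.trans hlK, fun i => QExt.isLocal_trevisan_apply hloc S hS.card_eq i⟩⟩
  · have hmn' : (m : ℝ) ≤ n := by exact_mod_cast hmn
    have hn : (0 : ℝ) < n := hm.trans_le hmn'
    set U := Real.logb 2 (n / ε) with hU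
    have huU : 1 ≤ U := hu1.trans (Real.logb_le_logb_of_le (by norm_num) (by positivity)
      (by gcongr))
    have hlog : Real.logb 2 (n / δ) ≤ 7 * U := by
      have h1 : (n : ℝ) / δ ≤ 9 * (n / ε) ^ 3 := by
        have h2 : (n : ℝ) / δ = 9 * (n * (m / ε) ^ 2) := by
          rw [← mul_one_div, hδ9]; ring
        have h3 : (n : ℝ) ≤ n / ε := le_div_self hn.le hε hε1
        rw [h2]
        calc 9 * ((n : ℝ) * (m / ε) ^ 2) ≤ 9 * ((n / ε) * (n / ε) ^ 2) := by gcongr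
          _ = _ := by ring
      refine (Real.logb_le_logb_of_le (by norm_num) (by positivity) h1).trans ?_
      rw [Real.logb_mul (by norm_num) (by positivity), Real.logb_pow]
      push_cast
      linarith [QExt.logb_nine_le]
    have ht : (t : ℝ) ≤ A * (7 * U) := hC.seed_le.trans (by gcongr)
    calc (d : ℝ) ≤ B * (t : ℝ) ^ 2 := hd
      _ ≤ B * (A * (7 * U)) ^ 2 := by gcongr
      _ = 49 * (B * A ^ 2) * U ^ 2 := by ring
      _ ≤ _ := by gcongr; linarith
  · push_cast
    have := mul_le_mul_of_nonneg_left (hl6.trans hlK) hm.le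
    linarith
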